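/- **Setting.** A *model* of the type theory $\mathbb T_{\Pi,\mathbf B}$ is a category $\mathcal S$ with a terminal object and, in presheaves over $\mathcal S$, a presheaf $\mathsf{Ty}$ of types, a locally representable dependent presheaf $\mathsf{Tm}$ of terms over it (local representability = context extensions), $\Pi$-types with natural isomorphisms $\mathsf{app}:\mathsf{Tm}(\Pi\,A\,B)\simeq((a:\mathsf{Tm}\,A)\to\mathsf{Tm}(B\,a))$, and a type $\mathbf B$ with $\mathsf{true}$, $\mathsf{false}$ and a dependent eliminator satisfying the two $\beta$-equations. Morphisms of models are functors with actions on types and terms that preserve the terminal object and context extensions up to isomorphism and the operations strictly; 2-cells are natural isomorphisms compatible with these actions. A *renaming algebra* over $\mathcal S$ is a category $\mathcal R$ with a terminal object, a functor $F:\mathcal R\to\mathcal S$ preserving it, a locally representable dependent presheaf $\mathsf{Var}$ over $F^*\mathsf{Ty}$, and an action $\mathsf{var}:\mathsf{Var}\,A\to F^*\mathsf{Tm}\,A$ preserving context extensions; morphisms are functors over $\mathcal S$ (up to isomorphism) with a compatible action on variables that preserve the terminal object and context extensions, and 2-cells are compatible natural isomorphisms. Let $\mathbf 0$ be a biinitial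 model and $F:\mathcal{Ren}\to\mathbf 0$ a biinitial renaming algebra over $\mathbf 0$. All categories and presheaves are small; biinitiality of $\mathbf 0$ also refers to models with a large set of objects. A *displayed model without context extensions* $\mathbf 0^\bullet$ over a functor $F:\mathcal C\to\mathbf 0$ consists, in presheaves over $\mathcal C$, of presheaves $\mathsf{Ty}^\bullet$ over $F^*\mathsf{Ty}$ and $\mathsf{Tm}^\bullet\,A^\bullet\,a$ (for $A^\bullet:\mathsf{Ty}^\bullet A$ and $a:F^*\mathsf{Tm}\,A$), with displayed versions of all operations and equations. It *has context extensions* if $\mathcal C$ has a terminal object preserved by $F$ and, for all $A^\bullet$ over $A$, the presheaf of pairs $(a,a^\bullet)$ with $a^\bullet:\mathsf{Tm}^\bullet A^\bullet a$ is locally representable and its first projection preserves context extensions. A *section* of such a model over $G:\mathcal P\to\mathbf 0$ is a functor $S_0:\mathbf 0\to\mathcal P$ with $S_0\cdot G\simeq 1$ and actions on types and terms over this isomorphism that preserve the terminal object, context extensions and all operations. A *factorization* of $\mathbf 0^\bullet$ over $F:\mathcal C\to\mathbf 0$ consists of functors $Y:\mathcal C\to\mathcal P$ (fully faithful) and $G:\mathcal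 P\to\mathbf 0$ with $Y\cdot G\simeq F$, a displayed model with context extensions $\mathbf 0^\dagger$ over $G$, and bijective actions of $Y$ on displayed types and terms that preserve the displayed operations. Given a factorization and a section $S_0$ of $\mathbf 0^\dagger$, the *displayed inserter* $\mathcal I$, with projection $I:\mathcal I\to\mathcal C$, has as objects pairs $(x,\iota)$ of an object $x$ of $\mathcal C$ and $\iota:Yx\to S_0(Fx)$ lying over $\mathrm{id}_{Fx}$, and as morphisms the morphisms of $\mathcal C$ commuting with the $\iota$'s. For $(x,\iota)$ and a type $A$ (resp. term $a$) over $Fx$, let $S_\iota^{\mathsf{Ty}}A$ (resp. $S_\iota^{\mathsf{Tm}}a$) be the unique displayed type (term) of $\mathbf 0^\bullet$ over $x$ that $Y$ sends to $(S_0A)[\iota]$ (resp. $(S_0a)[\iota]$). A *relative section* $S_\alpha$ of the factorization is a section $S_0$ of $\mathbf 0^\dagger$ with a natural transformation $\alpha:Y\Rightarrow F\cdot S_0$ over $1_F$, equivalently a section $\langle\alpha\rangle:x\mapsto(x,\alpha_x)$ of $I$; its action on terms is $S_\alpha^{\mathsf{Tm}}a=S_{\alpha_x}^{\mathsf{Tm}}a$.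 **Lemma (induction principle relative to $\mathcal{Ren}\to\mathbf 0_{\mathbb T_{\Pi,\mathbf B}}$).** Let $\mathbf 0^\bullet$ be a displayed model without context extensions over $F:\mathcal{Ren}\to\mathbf 0$. Then $\mathbf 0^\bullet$ has a factorization, and for every factorization the displayed model $\mathbf 0^\dagger$ has a section. Moreover, for every factorization and every section $S_0$ of $\mathbf 0^\dagger$, suppose given displayed interpretations of variables: for every object $X=(x,\iota)$ of $\mathcal I$, every type $A$ over $Fx$, every $\rho:y\to x$ in $\mathcal{Ren}$ and every variable $a:\mathsf{Var}_y(A[F\rho])$, a displayed term $$\mathsf{var}^\bullet_{X,A}(\rho,a):\mathsf{Tm}^\bullet_y\bigl((S_\iota^{\mathsf{Ty}}A)[\rho]\bigr)(\mathsf{var}\,a),$$ natural in $y$ and in $X\in\mathcal I$. Then there is a relative section $S_\alpha=(S_0,\alpha)$ of the factorization, and it satisfies, for every object $x$ of $\mathcal{Ren}$, every type $A$ over $Fx$ and every $a:\mathsf{Var}_x(A)$, $$S_\alpha^{\mathsf{Tm}}(\mathsf{var}\,a)=\mathsf{var}^\bullet_{(x,\alpha_x),A}(\mathrm{id}_x,a).$$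 -/

import Mathlib

open CategoryTheory CategoryTheory.Limits Opposite

universe t h₁ h₂ h₃ o₁ o₂ o₃ u

namespace RelativeInduction

/-! ### Presheaves, their actions along functors, and local representability -/

section Presheaves

variable {C : Type o₁} [Category.{h₁} C] {D : Type o₂} [Category.{h₂} D]

/-- The restriction `x[σ]` of an element of a presheaf along a morphism. -/
def res (X : Cᵒᵖ ⥤ Type t) {Γ Δ : C} (σ : Δ ⟶ Γ) (x : X.obj (op Γ)) : X.obj (op Δ) :=
  X.map σ.op x

/-- The component at `Γ` of a map of presheaves over the same category. -/
def ap {X Y : Cᵒᵖ ⥤ Type t} (f : X ⟶ Y) {Γ : C} (x : X.obj (op Γ)) : Y.obj (op Γ) :=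
  f.app (op Γ) x

/-- The component at `Γ` of an action of a functor `F`, i.e. of a map `X ⟶ F^* X'`. -/
def act {F : C ⥤ D} {X : Cᵒᵖ ⥤ Type t} {X' : Dᵒᵖ ⥤ Type t} (f : X ⟶ F.op ⋙ X') {Γ : C}
    (x : X.obj (op Γ)) : X'.obj (op (F.obj Γ)) :=
  f.app (op Γ) x

theorem res_id (X : Cᵒᵖ ⥤ Type t) {Γ : C} (x : X.obj (op Γ)) : res X (𝟙 Γ) x = x := by
  simp [res]

theorem res_comp (X : Cᵒᵖ ⥤ Type t) {Γ Δ Θ : C} (τ : Θ ⟶ Δ) (σ : Δ ⟶ Γ) (x : X.obj (op Γ)) :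
    res X (τ ≫ σ) x = res X τ (res X σ x) := by
  simp [res]

theorem ap_res {X Y : Cᵒᵖ ⥤ Type t} (f : X ⟶ Y) {Γ Δ : C} (σ : Δ ⟶ Γ) (x : X.obj (op Γ)) :
    ap f (res X σ x) = res Y σ (ap f x) :=
  NatTrans.naturality_apply f σ.op x

theorem act_res {F : C ⥤ D} {X : Cᵒᵖ ⥤ Type t} {X' : Dᵒᵖ ⥤ Type t} (f : X ⟶ F.op ⋙ X')
    {Γ Δ : C} (σ : Δ ⟶ Γ) (x : X.obj (op Γ)) :
    act f (res X σ x) = res X' (F.map σ) (act f x) :=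
  NatTrans.naturality_apply f σ.op x

/-- A dependent presheaf over `X` is given by its total map `π : Y ⟶ X`. The object `E`, the
projection `p : E ⟶ Γ` and the generic element `q` form a context extension of `Γ` by the
restriction of this dependent presheaf to `x`: they represent the presheaf
`σ ↦ {y | π y = x[σ]}` on the slice over `Γ`. -/
structure IsExtension {X Y : Cᵒᵖ ⥤ Type t} (π : Y ⟶ X) {Γ : C} (x : X.obj (op Γ)) {E : C}
    (p : E ⟶ Γ) (q : Y.obj (op E)) : Prop where
  isOver : ap π q = res X p x
  existsUnique_lift : ∀ {Δ : C} (σ : Δ ⟶ Γ) (y : Y.obj (op Δ)), ap π y = res X σ x →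
    ∃! τ : Δ ⟶ E, τ ≫ p = σ ∧ res Y τ q = y

/-- Local representability of a dependent presheaf, given by its total map. -/
def IsLocallyRepresentable {X Y : Cᵒᵖ ⥤ Type t} (π : Y ⟶ X) : Prop :=
  ∀ (Γ : C) (x : X.obj (op Γ)), ∃ (E : C) (p : E ⟶ Γ) (q : Y.obj (op E)), IsExtension π x p q

/-- Preservation of context extensions (up to isomorphism) by an action of `F` on two dependent
presheaves: representations are sent to representations. -/
def PreservesExtensions (F : C ⥤ D) {X Y : Cᵒᵖ ⥤ Type t} (π : Y ⟶ X) {X' Y' : Dᵒᵖ ⥤ Type t}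
    (π' : Y' ⟶ X') (f : X ⟶ F.op ⋙ X') (g : Y ⟶ F.op ⋙ Y') : Prop :=
  ∀ ⦃Γ : C⦄ (x : X.obj (op Γ)) ⦃E : C⦄ (p : E ⟶ Γ) (q : Y.obj (op E)),
    IsExtension π x p q → IsExtension π' (act f x) (F.map p) (act g q)

/-- Preservation of terminal objects. -/
def PreservesTerminal (F : C ⥤ D) : Prop :=
  ∀ X : C, Nonempty (IsTerminal X) → Nonempty (IsTerminal (F.obj X))

end Presheaves

/-! ### Types, terms, and dependent families -/

/-- A presheaf of types together with a dependent presheaf of terms, given by its total map. -/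
structure TypeFamily (C : Type o₁) [Category.{h₁} C] where
  Ty : Cᵒᵖ ⥤ Type t
  Tm : Cᵒᵖ ⥤ Type t
  tp : Tm ⟶ Ty

namespace TypeFamily

variable {C : Type o₁} [Category.{h₁} C]

theorem tp_res (T : TypeFamily.{t} C) {Γ Δ Θ : C} {A : T.Ty.obj (op Γ)} (τ : Θ ⟶ Δ)
    {σ : Δ ⟶ Γ} {a : T.Tm.obj (op Δ)} (h : ap T.tp a = res T.Ty σ A) :
    ap T.tp (res T.Tm τ a) = res T.Ty (τ ≫ σ) A := by
  rw [ap_res, h, res_comp]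

theorem tp_id (T : TypeFamily.{t} C) {Γ : C} {A : T.Ty.obj (op Γ)} {a : T.Tm.obj (op Γ)}
    (h : ap T.tp a = A) : ap T.tp a = res T.Ty (𝟙 Γ) A := by
  rw [h, res_id]

theorem tp_restrict (T : TypeFamily.{t} C) {Γ Δ Θ : C} {A : T.Ty.obj (op Γ)} {σ : Δ ⟶ Γ}
    {A' : T.Ty.obj (op Δ)} (e : res T.Ty σ A = A') {τ : Θ ⟶ Δ} {a : T.Tm.obj (op Θ)}
    (h : ap T.tp a = res T.Ty τ A') : ap T.tp a = res T.Ty (τ ≫ σ) A := by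
  rw [h, ← e, res_comp]

end TypeFamily

/-- The elements at `Γ` of the presheaf exponential `Tm A → X`. For `X = Ty` these are the
families `B : Tm A → Ty`; the elements of `(a : Tm A) → Tm (B a)` are those `b : Tm A → Tm` with
`tp ∘ b = B`. -/
@[ext]
structure Fam {C : Type o₁} [Category.{h₁} C] (T : TypeFamily.{t} C) {Γ : C}
    (A : T.Ty.obj (op Γ)) (X : Cᵒᵖ ⥤ Type t) where
  val : ∀ {Δ : C} (σ : Δ ⟶ Γ) (a : T.Tm.obj (op Δ)), ap T.tp a = res T.Ty σ A → X.obj (op Δ)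
  val_res : ∀ {Δ Θ : C} (τ : Θ ⟶ Δ) (σ : Δ ⟶ Γ) (a : T.Tm.obj (op Δ))
    (h : ap T.tp a = res T.Ty σ A),
    res X τ (val σ a h) = val (τ ≫ σ) (res T.Tm τ a) (T.tp_res τ h)

namespace Fam

variable {C : Type o₁} [Category.{h₁} C] {T : TypeFamily.{t} C} {Γ : C} {A : T.Ty.obj (op Γ)}
  {X X' : Cᵒᵖ ⥤ Type t}

/-- Application of a family at its own stage. -/
def at' (B : Fam T A X) (a : T.Tm.obj (op Γ)) (h : ap T.tp a = A) : X.obj (op Γ) :=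
  B.val (𝟙 Γ) a (T.tp_id h)

/-- Restriction of a family; `A'` is `A[σ]`. -/
def restrict (B : Fam T A X) {Δ : C} (σ : Δ ⟶ Γ) {A' : T.Ty.obj (op Δ)}
    (e : res T.Ty σ A = A') : Fam T A' X where
  val τ a h := B.val (τ ≫ σ) a (T.tp_restrict e h)
  val_res τ σ' a h := by
    rw [B.val_res]
    congr 1
    simp

/-- Postcomposition of a family with a map of presheaves. -/
def map (B : Fam T A X) (f : X ⟶ X') : Fam T A X' where
  val σ a h := ap f (B.val σ a h)
  val_res τ σ a h := by rw [← ap_res, B.val_res]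

end Fam

/-- Actions of a functor `F` on types and terms. -/
structure FamilyMap {C : Type o₁} [Category.{h₁} C] {D : Type o₂} [Category.{h₂} D] (F : C ⥤ D)
    (T : TypeFamily.{t} C) (T' : TypeFamily.{t} D) where
  ty : T.Ty ⟶ F.op ⋙ T'.Ty
  tm : T.Tm ⟶ F.op ⋙ T'.Tm
  tp_tm : ∀ {Γ : C} (a : T.Tm.obj (op Γ)), ap T'.tp (act tm a) = act ty (ap T.tp a)

namespace FamilyMap

variable {C : Type o₁} [Category.{h₁} C] {D : Type o₂} [Category.{h₂} D] {F : C ⥤ D}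
  {T : TypeFamily.{t} C} {T' : TypeFamily.{t} D}

theorem tp_tm_eq (φ : FamilyMap F T T') {Γ Δ : C} {A : T.Ty.obj (op Γ)}
    {A' : T'.Ty.obj (op (F.obj Γ))} (hA : act φ.ty A = A') {σ : Δ ⟶ Γ} {a : T.Tm.obj (op Δ)}
    (h : ap T.tp a = res T.Ty σ A) : ap T'.tp (act φ.tm a) = res T'.Ty (F.map σ) A' := by
  rw [φ.tp_tm, h, act_res, hA]

/-- The family `B'` extends the image of the family `B` under the action of `F`:
`B' (F σ) (F a) = F (B σ a)`. If `F` preserves context extensions then every `B` has exactly one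
such `B'`, namely the image of `B` under the induced action of `F` on the sort of families. For
the projection of a displayed model the relation says that `B` lies over `B'`. -/
def Matches (φ : FamilyMap F T T') {Γ : C} {A : T.Ty.obj (op Γ)} {A' : T'.Ty.obj (op (F.obj Γ))}
    (hA : act φ.ty A = A') {X : Cᵒᵖ ⥤ Type t} {X' : Dᵒᵖ ⥤ Type t} (f : X ⟶ F.op ⋙ X')
    (B : Fam T A X) (B' : Fam T' A' X') : Prop :=
  ∀ ⦃Δ : C⦄ (σ : Δ ⟶ Γ) (a : T.Tm.obj (op Δ)) (h : ap T.tp a = res T.Ty σ A),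
    B'.val (F.map σ) (act φ.tm a) (φ.tp_tm_eq hA h) = act f (B.val σ a h)

theorem Matches.restrict {φ : FamilyMap F T T'} {Γ : C} {A : T.Ty.obj (op Γ)}
    {A' : T'.Ty.obj (op (F.obj Γ))} {hA : act φ.ty A = A'} {X : Cᵒᵖ ⥤ Type t}
    {X' : Dᵒᵖ ⥤ Type t} {f : X ⟶ F.op ⋙ X'} {B : Fam T A X} {B' : Fam T' A' X'}
    (hB : φ.Matches hA f B B') {Δ : C} (σ : Δ ⟶ Γ) {A₁ : T.Ty.obj (op Δ)}
    {A₁' : T'.Ty.obj (op (F.obj Δ))} (e : res T.Ty σ A = A₁)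
    (e' : res T'.Ty (F.map σ) A' = A₁') (hA₁ : act φ.ty A₁ = A₁') :
    φ.Matches hA₁ f (B.restrict σ e) (B'.restrict (F.map σ) e') := by
  intro Θ τ a h
  have := hB (τ ≫ σ) a (T.tp_restrict e h)
  simp only [Fam.restrict]
  rw [← this]
  congr 1
  simp

theorem Matches.mapTp {φ : FamilyMap F T T'} {Γ : C} {A : T.Ty.obj (op Γ)}
    {A' : T'.Ty.obj (op (F.obj Γ))} {hA : act φ.ty A = A'} {b : Fam T A T.Tm}
    {b' : Fam T' A' T'.Tm} (hb : φ.Matches hA φ.tm b b') :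
    φ.Matches hA φ.ty (b.map T.tp) (b'.map T'.tp) := by
  intro Δ σ a h
  simp only [Fam.map]
  rw [hb σ a h, φ.tp_tm]

end FamilyMap

/-! ### Models of the type theory with Π-types and booleans -/

/-- A model: a category with a terminal object and, in presheaves over it, a type family with
locally representable terms, Π-types and booleans. The isomorphism
`app : Tm (Π A B) ≃ ((a : Tm A) → Tm (B a))` is given by its inverse `lam`, which is natural and
bijective; application is `b ↦ b a` under this bijection. -/
structure Model (C : Type o₁) [Category.{h₁} C] extends TypeFamily.{t} C where
  hasTerminal : HasTerminal C
  rep : IsLocallyRepresentable tp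
  Pi : ∀ {Γ : C} (A : Ty.obj (op Γ)) (_ : Fam toTypeFamily A Ty), Ty.obj (op Γ)
  Pi_res : ∀ {Γ Δ : C} (σ : Δ ⟶ Γ) (A : Ty.obj (op Γ)) (B : Fam toTypeFamily A Ty),
    res Ty σ (Pi A B) = Pi (res Ty σ A) (B.restrict σ rfl)
  lam : ∀ {Γ : C} (A : Ty.obj (op Γ)) (_ : Fam toTypeFamily A Tm), Tm.obj (op Γ)
  lam_res : ∀ {Γ Δ : C} (σ : Δ ⟶ Γ) (A : Ty.obj (op Γ)) (b : Fam toTypeFamily A Tm),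
    res Tm σ (lam A b) = lam (res Ty σ A) (b.restrict σ rfl)
  tp_lam : ∀ {Γ : C} (A : Ty.obj (op Γ)) (b : Fam toTypeFamily A Tm),
    ap tp (lam A b) = Pi A (b.map tp)
  lam_bijective : ∀ {Γ : C} (A : Ty.obj (op Γ)) (B : Fam toTypeFamily A Ty)
    (f : Tm.obj (op Γ)), ap tp f = Pi A B →
    ∃! b : Fam toTypeFamily A Tm, b.map tp = B ∧ lam A b = f
  bool : ∀ Γ : C, Ty.obj (op Γ)
  bool_res : ∀ {Γ Δ : C} (σ : Δ ⟶ Γ), res Ty σ (bool Γ) = bool Δ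
  tt : ∀ Γ : C, Tm.obj (op Γ)
  tt_res : ∀ {Γ Δ : C} (σ : Δ ⟶ Γ), res Tm σ (tt Γ) = tt Δ
  tp_tt : ∀ Γ : C, ap tp (tt Γ) = bool Γ
  ff : ∀ Γ : C, Tm.obj (op Γ)
  ff_res : ∀ {Γ Δ : C} (σ : Δ ⟶ Γ), res Tm σ (ff Γ) = ff Δ
  tp_ff : ∀ Γ : C, ap tp (ff Γ) = bool Γ
  boolElim : ∀ {Γ : C} (P : Fam toTypeFamily (bool Γ) Ty) (t f b : Tm.obj (op Γ)),
    ap tp t = P.at' (tt Γ) (tp_tt Γ) → ap tp f = P.at' (ff Γ) (tp_ff Γ) → ap tp b = bool Γ →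
    Tm.obj (op Γ)
  tp_boolElim : ∀ {Γ : C} (P : Fam toTypeFamily (bool Γ) Ty) (t f b : Tm.obj (op Γ))
    (ht : ap tp t = P.at' (tt Γ) (tp_tt Γ)) (hf : ap tp f = P.at' (ff Γ) (tp_ff Γ))
    (hb : ap tp b = bool Γ), ap tp (boolElim P t f b ht hf hb) = P.at' b hb
  boolElim_res : ∀ {Γ Δ : C} (σ : Δ ⟶ Γ) (P : Fam toTypeFamily (bool Γ) Ty)
    (t f b : Tm.obj (op Γ))
    (ht : ap tp t = P.at' (tt Γ) (tp_tt Γ)) (hf : ap tp f = P.at' (ff Γ) (tp_ff Γ))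
    (hb : ap tp b = bool Γ) (ht' hf' hb'),
    res Tm σ (boolElim P t f b ht hf hb) =
      boolElim (P.restrict σ (bool_res σ)) (res Tm σ t) (res Tm σ f) (res Tm σ b) ht' hf' hb'
  boolElim_tt : ∀ {Γ : C} (P : Fam toTypeFamily (bool Γ) Ty) (t f : Tm.obj (op Γ))
    (ht : ap tp t = P.at' (tt Γ) (tp_tt Γ)) (hf : ap tp f = P.at' (ff Γ) (tp_ff Γ)),
    boolElim P t f (tt Γ) ht hf (tp_tt Γ) = t
  boolElim_ff : ∀ {Γ : C} (P : Fam toTypeFamily (bool Γ) Ty) (t f : Tm.obj (op Γ))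
    (ht : ap tp t = P.at' (tt Γ) (tp_tt Γ)) (hf : ap tp f = P.at' (ff Γ) (tp_ff Γ)),
    boolElim P t f (ff Γ) ht hf (tp_ff Γ) = f

/-- Morphisms of models: functors with actions on types and terms that preserve the terminal
object and context extensions up to isomorphism and the type-theoretic operations strictly.
(Preservation of `lam` is equivalent to preservation of its inverse `app`. The typing hypotheses
with a prime follow from those without.) -/
structure ModelHom {C : Type o₁} [Category.{h₁} C] {D : Type o₂} [Category.{h₂} D]
    (M : Model.{t} C) (N : Model.{t} D) where
  functor : C ⥤ D
  map : FamilyMap functor M.toTypeFamily N.toTypeFamily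
  terminal : PreservesTerminal functor
  ext : PreservesExtensions functor M.tp N.tp map.ty map.tm
  Pi : ∀ {Γ : C} (A : M.Ty.obj (op Γ)) (B : Fam M.toTypeFamily A M.Ty)
    (B' : Fam N.toTypeFamily (act map.ty A) N.Ty), map.Matches rfl map.ty B B' →
    act map.ty (M.Pi A B) = N.Pi (act map.ty A) B'
  lam : ∀ {Γ : C} (A : M.Ty.obj (op Γ)) (b : Fam M.toTypeFamily A M.Tm)
    (b' : Fam N.toTypeFamily (act map.ty A) N.Tm), map.Matches rfl map.tm b b' →
    act map.tm (M.lam A b) = N.lam (act map.ty A) b'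
  bool : ∀ Γ : C, act map.ty (M.bool Γ) = N.bool (functor.obj Γ)
  tt : ∀ Γ : C, act map.tm (M.tt Γ) = N.tt (functor.obj Γ)
  ff : ∀ Γ : C, act map.tm (M.ff Γ) = N.ff (functor.obj Γ)
  boolElim : ∀ {Γ : C} (P : Fam M.toTypeFamily (M.bool Γ) M.Ty)
    (P' : Fam N.toTypeFamily (N.bool (functor.obj Γ)) N.Ty),
    map.Matches (bool Γ) map.ty P P' → ∀ (t f b : M.Tm.obj (op Γ)) (ht hf hb ht' hf' hb'),
    act map.tm (M.boolElim P t f b ht hf hb) =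
      N.boolElim P' (act map.tm t) (act map.tm f) (act map.tm b) ht' hf' hb'

/-- 2-cells between morphisms of models: natural isomorphisms of the underlying functors that
are compatible with the actions on types and terms. -/
structure ModelHom.IsTwoCell {C : Type o₁} [Category.{h₁} C] {D : Type o₂} [Category.{h₂} D]
    {M : Model.{t} C} {N : Model.{t} D} (f g : ModelHom M N) (θ : f.functor ≅ g.functor) :
    Prop where
  ty : ∀ {Γ : C} (A : M.Ty.obj (op Γ)), act f.map.ty A = res N.Ty (θ.hom.app Γ) (act g.map.ty A)
  tm : ∀ {Γ : C} (a : M.Tm.obj (op Γ)), act f.map.tm a = res N.Tm (θ.hom.app Γ) (act g.map.tm a)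

/-- Biinitiality among the models of the indicated sizes: up to a unique 2-cell there is exactly
one morphism to every such model. -/
def Model.IsBiinitial.{o, h, t', o', h'} {C : Type o} [Category.{h} C] (M : Model.{t'} C) :
    Prop :=
  ∀ (D : Type o') [Category.{h'} D] (N : Model.{t'} D), Nonempty (ModelHom M N) ∧
    ∀ f g : ModelHom M N, ∃! θ : f.functor ≅ g.functor, ModelHom.IsTwoCell f g θ

/-! ### Displayed models -/

/-- A (global) displayed model without context extensions over a functor `F` into a model `M`.
The displayed types over `A` are the elements of `Ty` with base `A`, and the displayed terms over
`a` of displayed type `A'` are the elements of `Tm` with base `a` and type `A'`. In the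
operations, `B'`, `b'`, `P'` are displayed families over families `B`, `b`, `P` of `M`. -/
structure DispModel {C : Type o₁} [Category.{h₁} C] {S : Type o₂} [Category.{h₂} S] (F : C ⥤ S)
    (M : Model.{t} S) extends TypeFamily.{t} C where
  base : FamilyMap F toTypeFamily M.toTypeFamily
  Pi : ∀ {Γ : C} {A : M.Ty.obj (op (F.obj Γ))} (B : Fam M.toTypeFamily A M.Ty)
    (A' : Ty.obj (op Γ)) (hA : act base.ty A' = A) (B' : Fam toTypeFamily A' Ty),
    base.Matches hA base.ty B' B → Ty.obj (op Γ)
  base_Pi : ∀ {Γ : C} {A : M.Ty.obj (op (F.obj Γ))} (B : Fam M.toTypeFamily A M.Ty)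
    (A' : Ty.obj (op Γ)) (hA : act base.ty A' = A) (B' : Fam toTypeFamily A' Ty)
    (hB : base.Matches hA base.ty B' B), act base.ty (Pi B A' hA B' hB) = M.Pi A B
  Pi_res : ∀ {Γ Δ : C} (σ : Δ ⟶ Γ) {A : M.Ty.obj (op (F.obj Γ))} (B : Fam M.toTypeFamily A M.Ty)
    (A' : Ty.obj (op Γ)) (hA : act base.ty A' = A) (B' : Fam toTypeFamily A' Ty)
    (hB : base.Matches hA base.ty B' B)
    (hA' : act base.ty (res Ty σ A') = res M.Ty (F.map σ) A),
    res Ty σ (Pi B A' hA B' hB) =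
      Pi (B.restrict (F.map σ) rfl) (res Ty σ A') hA' (B'.restrict σ rfl)
        (hB.restrict σ rfl rfl hA')
  lam : ∀ {Γ : C} {A : M.Ty.obj (op (F.obj Γ))} (b : Fam M.toTypeFamily A M.Tm)
    (A' : Ty.obj (op Γ)) (hA : act base.ty A' = A) (b' : Fam toTypeFamily A' Tm),
    base.Matches hA base.tm b' b → Tm.obj (op Γ)
  base_lam : ∀ {Γ : C} {A : M.Ty.obj (op (F.obj Γ))} (b : Fam M.toTypeFamily A M.Tm)
    (A' : Ty.obj (op Γ)) (hA : act base.ty A' = A) (b' : Fam toTypeFamily A' Tm)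
    (hb : base.Matches hA base.tm b' b), act base.tm (lam b A' hA b' hb) = M.lam A b
  lam_res : ∀ {Γ Δ : C} (σ : Δ ⟶ Γ) {A : M.Ty.obj (op (F.obj Γ))}
    (b : Fam M.toTypeFamily A M.Tm)
    (A' : Ty.obj (op Γ)) (hA : act base.ty A' = A) (b' : Fam toTypeFamily A' Tm)
    (hb : base.Matches hA base.tm b' b)
    (hA' : act base.ty (res Ty σ A') = res M.Ty (F.map σ) A),
    res Tm σ (lam b A' hA b' hb) =
      lam (b.restrict (F.map σ) rfl) (res Ty σ A') hA' (b'.restrict σ rfl)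
        (hb.restrict σ rfl rfl hA')
  tp_lam : ∀ {Γ : C} {A : M.Ty.obj (op (F.obj Γ))} (b : Fam M.toTypeFamily A M.Tm)
    (A' : Ty.obj (op Γ)) (hA : act base.ty A' = A) (b' : Fam toTypeFamily A' Tm)
    (hb : base.Matches hA base.tm b' b),
    ap tp (lam b A' hA b' hb) = Pi (b.map M.tp) A' hA (b'.map tp) hb.mapTp
  /-- For a term `f = lam b` of `Π A B`, displayed terms of `Π A' B'` over `f` correspond
  bijectively to displayed families of terms of `B'` over `b`. -/
  lam_bijective : ∀ {Γ : C} {A : M.Ty.obj (op (F.obj Γ))} (B : Fam M.toTypeFamily A M.Ty)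
    (A' : Ty.obj (op Γ)) (hA : act base.ty A' = A) (B' : Fam toTypeFamily A' Ty)
    (hB : base.Matches hA base.ty B' B) (b : Fam M.toTypeFamily A M.Tm), b.map M.tp = B →
    ∀ f' : Tm.obj (op Γ), ap tp f' = Pi B A' hA B' hB → act base.tm f' = M.lam A b →
    ∃! b' : Fam toTypeFamily A' Tm, b'.map tp = B' ∧
      ∃ hb : base.Matches hA base.tm b' b, lam b A' hA b' hb = f'
  bool : ∀ Γ : C, Ty.obj (op Γ)
  bool_res : ∀ {Γ Δ : C} (σ : Δ ⟶ Γ), res Ty σ (bool Γ) = bool Δ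
  base_bool : ∀ Γ : C, act base.ty (bool Γ) = M.bool (F.obj Γ)
  tt : ∀ Γ : C, Tm.obj (op Γ)
  tt_res : ∀ {Γ Δ : C} (σ : Δ ⟶ Γ), res Tm σ (tt Γ) = tt Δ
  tp_tt : ∀ Γ : C, ap tp (tt Γ) = bool Γ
  base_tt : ∀ Γ : C, act base.tm (tt Γ) = M.tt (F.obj Γ)
  ff : ∀ Γ : C, Tm.obj (op Γ)
  ff_res : ∀ {Γ Δ : C} (σ : Δ ⟶ Γ), res Tm σ (ff Γ) = ff Δ
  tp_ff : ∀ Γ : C, ap tp (ff Γ) = bool Γ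
  base_ff : ∀ Γ : C, act base.tm (ff Γ) = M.ff (F.obj Γ)
  boolElim : ∀ {Γ : C} (P : Fam M.toTypeFamily (M.bool (F.obj Γ)) M.Ty)
    (P' : Fam toTypeFamily (bool Γ) Ty), base.Matches (base_bool Γ) base.ty P' P →
    ∀ t' f' b' : Tm.obj (op Γ), ap tp t' = P'.at' (tt Γ) (tp_tt Γ) →
    ap tp f' = P'.at' (ff Γ) (tp_ff Γ) → ap tp b' = bool Γ → Tm.obj (op Γ)
  base_boolElim : ∀ {Γ : C} (P : Fam M.toTypeFamily (M.bool (F.obj Γ)) M.Ty)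
    (P' : Fam toTypeFamily (bool Γ) Ty) (hP : base.Matches (base_bool Γ) base.ty P' P)
    (t' f' b' : Tm.obj (op Γ)) (ht hf hb ht' hf' hb'),
    act base.tm (boolElim P P' hP t' f' b' ht hf hb) =
      M.boolElim P (act base.tm t') (act base.tm f') (act base.tm b') ht' hf' hb'
  tp_boolElim : ∀ {Γ : C} (P : Fam M.toTypeFamily (M.bool (F.obj Γ)) M.Ty)
    (P' : Fam toTypeFamily (bool Γ) Ty) (hP : base.Matches (base_bool Γ) base.ty P' P)
    (t' f' b' : Tm.obj (op Γ)) (ht hf) (hb : ap tp b' = bool Γ),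
    ap tp (boolElim P P' hP t' f' b' ht hf hb) = P'.at' b' hb
  boolElim_res : ∀ {Γ Δ : C} (σ : Δ ⟶ Γ) (P : Fam M.toTypeFamily (M.bool (F.obj Γ)) M.Ty)
    (P' : Fam toTypeFamily (bool Γ) Ty) (hP : base.Matches (base_bool Γ) base.ty P' P)
    (t' f' b' : Tm.obj (op Γ)) (ht hf hb ht' hf' hb'),
    res Tm σ (boolElim P P' hP t' f' b' ht hf hb) =
      boolElim (P.restrict (F.map σ) (M.bool_res _)) (P'.restrict σ (bool_res σ))
        (hP.restrict σ _ _ (base_bool Δ)) (res Tm σ t') (res Tm σ f') (res Tm σ b') ht' hf' hb'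
  boolElim_tt : ∀ {Γ : C} (P : Fam M.toTypeFamily (M.bool (F.obj Γ)) M.Ty)
    (P' : Fam toTypeFamily (bool Γ) Ty) (hP : base.Matches (base_bool Γ) base.ty P' P)
    (t' f' : Tm.obj (op Γ)) (ht hf), boolElim P P' hP t' f' (tt Γ) ht hf (tp_tt Γ) = t'
  boolElim_ff : ∀ {Γ : C} (P : Fam M.toTypeFamily (M.bool (F.obj Γ)) M.Ty)
    (P' : Fam toTypeFamily (bool Γ) Ty) (hP : base.Matches (base_bool Γ) base.ty P' P)
    (t' f' : Tm.obj (op Γ)) (ht hf), boolElim P P' hP t' f' (ff Γ) ht hf (tp_ff Γ) = f'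

/-- A displayed model has context extensions if its total category has a terminal object,
preserved by the projection, and if for every displayed type `A'` over `A` the presheaf of pairs
`(a, a')` of a term of `A` and a displayed term of `A'` over it is locally representable, with
the first projection preserving context extensions. (These pairs are the elements of `Tm` of
type `A'`.) -/
structure DispModel.HasContextExtensions {C : Type o₁} [Category.{h₁} C] {S : Type o₂}
    [Category.{h₂} S] {F : C ⥤ S} {M : Model.{t} S} (D : DispModel F M) : Prop where
  hasTerminal : HasTerminal C
  terminal : PreservesTerminal F
  rep : IsLocallyRepresentable D.tp
  ext : PreservesExtensions F D.tp M.tp D.base.ty D.base.tm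

/-- A section of a displayed model `D` over `G : P ⥤ S`: a section of the functor `G` up to
natural isomorphism, with actions on types and terms that lie over the identity, preserve the
terminal object and context extensions, and preserve the type-theoretic operations. In `Pi`,
`lam` and `boolElim` the displayed family with a prime is the image of the given family. -/
structure DispSection {P : Type o₁} [Category.{h₁} P] {S : Type o₂} [Category.{h₂} S] {G : P ⥤ S}
    {M : Model.{t} S} (D : DispModel G M) where
  functor : S ⥤ P
  iso : functor ⋙ G ≅ 𝟭 S
  map : FamilyMap functor M.toTypeFamily D.toTypeFamily
  base_ty : ∀ {Γ : S} (A : M.Ty.obj (op Γ)),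
    act D.base.ty (act map.ty A) = res M.Ty (iso.hom.app Γ) A
  base_tm : ∀ {Γ : S} (a : M.Tm.obj (op Γ)),
    act D.base.tm (act map.tm a) = res M.Tm (iso.hom.app Γ) a
  terminal : PreservesTerminal functor
  ext : PreservesExtensions functor M.tp D.tp map.ty map.tm
  Pi : ∀ {Γ : S} (A : M.Ty.obj (op Γ)) (B : Fam M.toTypeFamily A M.Ty)
    (B' : Fam D.toTypeFamily (act map.ty A) D.Ty), map.Matches rfl map.ty B B' →
    ∀ hB, act map.ty (M.Pi A B) =
      D.Pi (B.restrict (iso.hom.app Γ) rfl) (act map.ty A) (base_ty A) B' hB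
  lam : ∀ {Γ : S} (A : M.Ty.obj (op Γ)) (b : Fam M.toTypeFamily A M.Tm)
    (b' : Fam D.toTypeFamily (act map.ty A) D.Tm), map.Matches rfl map.tm b b' →
    ∀ hb, act map.tm (M.lam A b) =
      D.lam (b.restrict (iso.hom.app Γ) rfl) (act map.ty A) (base_ty A) b' hb
  bool : ∀ Γ : S, act map.ty (M.bool Γ) = D.bool (functor.obj Γ)
  tt : ∀ Γ : S, act map.tm (M.tt Γ) = D.tt (functor.obj Γ)
  ff : ∀ Γ : S, act map.tm (M.ff Γ) = D.ff (functor.obj Γ)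
  boolElim : ∀ {Γ : S} (Q : Fam M.toTypeFamily (M.bool Γ) M.Ty)
    (Q' : Fam D.toTypeFamily (D.bool (functor.obj Γ)) D.Ty),
    map.Matches (bool Γ) map.ty Q Q' →
    ∀ (hQ) (t f b : M.Tm.obj (op Γ)) (ht hf hb ht' hf' hb'),
    act map.tm (M.boolElim Q t f b ht hf hb) =
      D.boolElim (Q.restrict (iso.hom.app Γ) (M.bool_res _)) Q' hQ
        (act map.tm t) (act map.tm f) (act map.tm b) ht' hf' hb'

/-! ### Factorizations, displayed inserters, relative sections -/

/-- A factorization `C ⥤ P ⥤ S` (by `Y` and `G`) of a displayed model without context extensions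
`D` over `F`: `Y` is fully faithful, `P` carries a displayed model `disp` with context extensions
over `G`, and `Y` has bijective actions on displayed types and terms, which lie over the
identity and preserve the displayed operations. In `Pi`, `lam` and `boolElim` a displayed family
over `Y Γ` (with two primes) is compared with the displayed family over `Γ` (with one prime) to
which it restricts along `Y`. (As `F ≅ Y ⋙ G` and as the actions commute with
the bases, bijectivity on the total sets is bijectivity over every type and every term.) -/
structure Factorization.{v} {C : Type v} [Category.{v} C] {S : Type v} [Category.{v} S]
    {F : C ⥤ S} {M : Model.{v} S} (D : DispModel F M) where
  P : Type (v + 1)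
  [cat : Category.{v} P]
  Y : C ⥤ P
  G : P ⥤ S
  fac : Y ⋙ G ≅ F
  full : Y.Full
  faithful : Y.Faithful
  disp : DispModel G M
  hasExt : disp.HasContextExtensions
  map : FamilyMap Y D.toTypeFamily disp.toTypeFamily
  base_ty : ∀ {Γ : C} (A : D.Ty.obj (op Γ)),
    act disp.base.ty (act map.ty A) = res M.Ty (fac.hom.app Γ) (act D.base.ty A)
  base_tm : ∀ {Γ : C} (a : D.Tm.obj (op Γ)),
    act disp.base.tm (act map.tm a) = res M.Tm (fac.hom.app Γ) (act D.base.tm a)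
  bij_ty : ∀ Γ : C, Function.Bijective (fun A : D.Ty.obj (op Γ) => act map.ty A)
  bij_tm : ∀ Γ : C, Function.Bijective (fun a : D.Tm.obj (op Γ) => act map.tm a)
  Pi : ∀ {Γ : C} {A : M.Ty.obj (op (F.obj Γ))} (B : Fam M.toTypeFamily A M.Ty)
    (A' : D.Ty.obj (op Γ)) (hA : act D.base.ty A' = A) (B' : Fam D.toTypeFamily A' D.Ty)
    (hB : D.base.Matches hA D.base.ty B' B)
    (B'' : Fam disp.toTypeFamily (act map.ty A') disp.Ty), map.Matches rfl map.ty B' B'' →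
    ∀ (hA'' : act disp.base.ty (act map.ty A') = res M.Ty (fac.hom.app Γ) A) (hB''),
    act map.ty (D.Pi B A' hA B' hB) =
      disp.Pi (B.restrict (fac.hom.app Γ) rfl) (act map.ty A') hA'' B'' hB''
  lam : ∀ {Γ : C} {A : M.Ty.obj (op (F.obj Γ))} (b : Fam M.toTypeFamily A M.Tm)
    (A' : D.Ty.obj (op Γ)) (hA : act D.base.ty A' = A) (b' : Fam D.toTypeFamily A' D.Tm)
    (hb : D.base.Matches hA D.base.tm b' b)
    (b'' : Fam disp.toTypeFamily (act map.ty A') disp.Tm), map.Matches rfl map.tm b' b'' →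
    ∀ (hA'' : act disp.base.ty (act map.ty A') = res M.Ty (fac.hom.app Γ) A) (hb''),
    act map.tm (D.lam b A' hA b' hb) =
      disp.lam (b.restrict (fac.hom.app Γ) rfl) (act map.ty A') hA'' b'' hb''
  bool : ∀ Γ : C, act map.ty (D.bool Γ) = disp.bool (Y.obj Γ)
  tt : ∀ Γ : C, act map.tm (D.tt Γ) = disp.tt (Y.obj Γ)
  ff : ∀ Γ : C, act map.tm (D.ff Γ) = disp.ff (Y.obj Γ)
  boolElim : ∀ {Γ : C} (Q : Fam M.toTypeFamily (M.bool (F.obj Γ)) M.Ty)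
    (Q' : Fam D.toTypeFamily (D.bool Γ) D.Ty) (hQ : D.base.Matches (D.base_bool Γ) D.base.ty Q' Q)
    (Q'' : Fam disp.toTypeFamily (disp.bool (Y.obj Γ)) disp.Ty),
    map.Matches (bool Γ) map.ty Q' Q'' →
    ∀ (hQ'') (t f b : D.Tm.obj (op Γ)) (ht hf hb ht' hf' hb'),
    act map.tm (D.boolElim Q Q' hQ t f b ht hf hb) =
      disp.boolElim (Q.restrict (fac.hom.app Γ) (M.bool_res _)) Q'' hQ''
        (act map.tm t) (act map.tm f) (act map.tm b) ht' hf' hb'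

attribute [instance] Factorization.cat

section Relative

variable {C : Type u} [Category.{u} C] {S : Type u} [Category.{u} S] {F : C ⥤ S}
  {M : Model.{u} S} {D : DispModel F M}

/-- Objects of the displayed inserter of `Y` and `F ⋙ S₀`: an object `pt` of `C` with a morphism
`ι : Y pt ⟶ S₀ (F pt)` over the identity of `F pt`. -/
structure Inserter (𝓕 : Factorization D) (S₀ : DispSection 𝓕.disp) where
  pt : C
  ι : 𝓕.Y.obj pt ⟶ S₀.functor.obj (F.obj pt)
  isOver : 𝓕.G.map ι ≫ S₀.iso.hom.app (F.obj pt) = 𝓕.fac.hom.app pt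

namespace Inserter

variable {𝓕 : Factorization D} {S₀ : DispSection 𝓕.disp}

/-- Morphisms of the displayed inserter: morphisms of `C` that commute with `ι`. -/
@[ext]
structure Hom (X X' : Inserter 𝓕 S₀) where
  hom : X.pt ⟶ X'.pt
  comm : 𝓕.Y.map hom ≫ X'.ι = X.ι ≫ S₀.functor.map (F.map hom)

instance : Category (Inserter 𝓕 S₀) where
  Hom := Hom
  id X := ⟨𝟙 X.pt, by simp⟩
  comp f g := ⟨f.hom ≫ g.hom, by
    simp only [Functor.map_comp, Category.assoc, g.comm]
    rw [← Category.assoc, f.comm, Category.assoc]⟩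
  id_comp f := Hom.ext (Category.id_comp f.hom)
  comp_id f := Hom.ext (Category.comp_id f.hom)
  assoc f g k := Hom.ext (Category.assoc f.hom g.hom k.hom)

variable (𝓕 S₀) in
/-- The projection `I` of the displayed inserter. -/
def proj : Inserter 𝓕 S₀ ⥤ C where
  obj X := X.pt
  map f := f.hom

/-- The action on types `S_ι`: the displayed type of `D` that `Y` sends to `(S₀ A)[ι]`. -/
noncomputable def sTy (X : Inserter 𝓕 S₀) (A : M.Ty.obj (op (F.obj X.pt))) :
    D.Ty.obj (op X.pt) :=
  (Equiv.ofBijective _ (𝓕.bij_ty X.pt)).symm (res 𝓕.disp.Ty X.ι (act S₀.map.ty A))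

/-- The action on terms `S_ι`: the displayed term of `D` that `Y` sends to `(S₀ a)[ι]`. -/
noncomputable def sTm (X : Inserter 𝓕 S₀) (a : M.Tm.obj (op (F.obj X.pt))) :
    D.Tm.obj (op X.pt) :=
  (Equiv.ofBijective _ (𝓕.bij_tm X.pt)).symm (res 𝓕.disp.Tm X.ι (act S₀.map.tm a))

end Inserter

/-- The second component of a relative section `(S₀, α)` of a factorization: a natural
transformation `α : Y ⟶ F ⋙ S₀` over the identity of `F`. -/
structure RelativeSection (𝓕 : Factorization D) (S₀ : DispSection 𝓕.disp) where
  α : 𝓕.Y ⟶ F ⋙ S₀.functor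
  isOver : ∀ x : C, 𝓕.G.map (α.app x) ≫ S₀.iso.hom.app (F.obj x) = 𝓕.fac.hom.app x

namespace RelativeSection

variable {𝓕 : Factorization D} {S₀ : DispSection 𝓕.disp}

/-- The section `⟨α⟩` of the projection of the displayed inserter that corresponds to `α`. -/
def toInserter (s : RelativeSection 𝓕 S₀) : C ⥤ Inserter 𝓕 S₀ where
  obj x := ⟨x, s.α.app x, s.isOver x⟩
  map f := ⟨f, s.α.naturality f⟩

/-- The action of a relative section on types. -/
noncomputable def onTy (s : RelativeSection 𝓕 S₀) {x : C} (A : M.Ty.obj (op (F.obj x))) :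
    D.Ty.obj (op x) :=
  (s.toInserter.obj x).sTy A

/-- The action of a relative section on terms. -/
noncomputable def onTm (s : RelativeSection 𝓕 S₀) {x : C} (a : M.Tm.obj (op (F.obj x))) :
    D.Tm.obj (op x) :=
  (s.toInserter.obj x).sTm a

end RelativeSection

end Relative

/-! ### Renaming algebras -/

/-- A renaming algebra over a model `M`. The dependent presheaf of variables is given by its
total map `vtp : Var ⟶ F^* Ty`. -/
structure RenamingAlgebra {S : Type o₂} [Category.{h₂} S] (M : Model.{t} S) (R : Type o₁)
    [Category.{h₁} R] where
  F : R ⥤ S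
  hasTerminal : HasTerminal R
  terminal : PreservesTerminal F
  Var : Rᵒᵖ ⥤ Type t
  vtp : Var ⟶ F.op ⋙ M.Ty
  rep : IsLocallyRepresentable vtp
  var : Var ⟶ F.op ⋙ M.Tm
  tp_var : ∀ {x : R} (a : Var.obj (op x)), ap M.tp (act var a) = act vtp a
  ext : PreservesExtensions F vtp M.tp (𝟙 (F.op ⋙ M.Ty)) var

/-- Morphisms of renaming algebras over `M`: functors over `S` (up to natural isomorphism) with
an action on variables, preserving the terminal object and context extensions. -/
structure RenamingHom {S : Type o₃} [Category.{h₃} S] {M : Model.{t} S} {R : Type o₁}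
    [Category.{h₁} R] {R' : Type o₂} [Category.{h₂} R'] (𝓡 : RenamingAlgebra M R)
    (𝓡' : RenamingAlgebra M R') where
  functor : R ⥤ R'
  iso : functor ⋙ 𝓡'.F ≅ 𝓡.F
  onVar : 𝓡.Var ⟶ functor.op ⋙ 𝓡'.Var
  vtp_onVar : ∀ {x : R} (a : 𝓡.Var.obj (op x)),
    act 𝓡'.vtp (act onVar a) = res M.Ty (iso.hom.app x) (act 𝓡.vtp a)
  var_onVar : ∀ {x : R} (a : 𝓡.Var.obj (op x)),
    act 𝓡'.var (act onVar a) = res M.Tm (iso.hom.app x) (act 𝓡.var a)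
  terminal : PreservesTerminal functor
  ext : PreservesExtensions functor 𝓡.vtp 𝓡'.vtp
    (Functor.whiskerRight (NatTrans.op iso.hom) M.Ty) onVar

/-- 2-cells between morphisms of renaming algebras: natural isomorphisms over `S` that are
compatible with the actions on variables. -/
structure RenamingHom.IsTwoCell {S : Type o₃} [Category.{h₃} S] {M : Model.{t} S} {R : Type o₁}
    [Category.{h₁} R] {R' : Type o₂} [Category.{h₂} R'] {𝓡 : RenamingAlgebra M R}
    {𝓡' : RenamingAlgebra M R'} (f g : RenamingHom 𝓡 𝓡') (θ : f.functor ≅ g.functor) : Prop where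
  isOver : ∀ x : R, 𝓡'.F.map (θ.hom.app x) ≫ g.iso.hom.app x = f.iso.hom.app x
  onVar : ∀ {x : R} (a : 𝓡.Var.obj (op x)),
    act f.onVar a = res 𝓡'.Var (θ.hom.app x) (act g.onVar a)

/-- Biinitiality among the renaming algebras over `M` of the same size. A category of renamings
over `M` is a biinitial renaming algebra over `M`. -/
def RenamingAlgebra.IsBiinitial {S : Type o₂} [Category.{h₂} S] {M : Model.{t} S} {R : Type o₁}
    [Category.{h₁} R] (𝓡 : RenamingAlgebra M R) : Prop :=
  ∀ (R' : Type o₁) [Category.{h₁} R'] (𝓡' : RenamingAlgebra M R'), Nonempty (RenamingHom 𝓡 𝓡') ∧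
    ∀ f g : RenamingHom 𝓡 𝓡', ∃! θ : f.functor ≅ g.functor, RenamingHom.IsTwoCell f g θ

/-- Displayed interpretations `var•` of the variables, internally to presheaves over the displayed
inserter. For an object `X` of the inserter and a type `A` over `F X.pt`, it gives a dependent
natural transformation, over the slice of `R` over `X.pt`, from the variables of type `A` to the
displayed terms of type `S_ι A` over their images under `var`; moreover it is natural in `X`. -/
structure VarInterpretation {S : Type u} [Category.{u} S] {M : Model.{u} S} {R : Type u}
    [Category.{u} R] (𝓡 : RenamingAlgebra M R) {D : DispModel 𝓡.F M} (𝓕 : Factorization D)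
    (S₀ : DispSection 𝓕.disp) where
  val : ∀ (X : Inserter 𝓕 S₀) (A : M.Ty.obj (op (𝓡.F.obj X.pt))) {y : R} (ρ : y ⟶ X.pt)
    (a : 𝓡.Var.obj (op y)), act 𝓡.vtp a = res M.Ty (𝓡.F.map ρ) A → D.Tm.obj (op y)
  tp_val : ∀ (X : Inserter 𝓕 S₀) (A : M.Ty.obj (op (𝓡.F.obj X.pt))) {y : R} (ρ : y ⟶ X.pt)
    (a : 𝓡.Var.obj (op y)) (h : act 𝓡.vtp a = res M.Ty (𝓡.F.map ρ) A),
    ap D.tp (val X A ρ a h) = res D.Ty ρ (X.sTy A)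
  base_val : ∀ (X : Inserter 𝓕 S₀) (A : M.Ty.obj (op (𝓡.F.obj X.pt))) {y : R} (ρ : y ⟶ X.pt)
    (a : 𝓡.Var.obj (op y)) (h : act 𝓡.vtp a = res M.Ty (𝓡.F.map ρ) A),
    act D.base.tm (val X A ρ a h) = act 𝓡.var a
  val_res : ∀ (X : Inserter 𝓕 S₀) (A : M.Ty.obj (op (𝓡.F.obj X.pt))) {y z : R} (τ : z ⟶ y)
    (ρ : y ⟶ X.pt) (a : 𝓡.Var.obj (op y)) (h : act 𝓡.vtp a = res M.Ty (𝓡.F.map ρ) A) (h'),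
    res D.Tm τ (val X A ρ a h) = val X A (τ ≫ ρ) (res 𝓡.Var τ a) h'
  val_map : ∀ {X X' : Inserter 𝓕 S₀} (θ : X ⟶ X') (A : M.Ty.obj (op (𝓡.F.obj X'.pt))) {y : R}
    (ρ : y ⟶ X.pt) (a : 𝓡.Var.obj (op y))
    (h : act 𝓡.vtp a = res M.Ty (𝓡.F.map ρ) (res M.Ty (𝓡.F.map θ.hom) A)) (h'),
    val X (res M.Ty (𝓡.F.map θ.hom) A) ρ a h = val X' A (ρ ≫ θ.hom) a h'

theorem RenamingAlgebra.vtp_id {S : Type o₂} [Category.{h₂} S] {M : Model.{t} S} {R : Type o₁}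
    [Category.{h₁} R] (𝓡 : RenamingAlgebra M R) {x : R} (a : 𝓡.Var.obj (op x)) :
    act 𝓡.vtp a = res M.Ty (𝓡.F.map (𝟙 x)) (act 𝓡.vtp a) := by
  rw [CategoryTheory.Functor.map_id, res_id]

end RelativeInduction

open RelativeInduction

/-! Each of the two biinitiality hypotheses is used in the same way: an algebra is built whose
projection to the biinitial one is a morphism, so the morphism out of the biinitial one splits this
projection up to a unique 2-cell.

Factorization. Glue `S` along the nerve of `F : C ⥤ S`: an object is a context `Γ` of `S` with a
presheaf over `C` mapping to `S(F -, Γ)`. A type over it is a type `A` of `M` over `Γ` together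
with, naturally in the elements `z` of the presheaf, a displayed type of `D` over `A[π z]`; terms
are similar. Over a representable, Yoneda identifies these data with those of `D`
(`mkElt_bijective`). A family over a glued object amounts to a family of `M` with compatible fibres
in `D` (`fam_ext`, `glueFam`), so each operation is computed by `M` on the base and by `D` in every
fibre. Context extensions, which `C` need not have for `D`, now exist because the presheaf of pairs
of an element and a displayed term is available (`isExtension_extObj`).

Section. With context extensions, a displayed family determines the family of `M` under it
(`FamilyMap.existsUnique_matches`). The operations of the displayed model then no longer depend on
base families, and the displayed model becomes a model `total` with a projection to `M`.
Biinitiality gives a morphism from `M` to `total`, and a 2-cell from its composite with the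
projection to the identity; this is a section.

Relative section. A transformation `α` is a section of the projection of the inserter, so the
inserter is made into a renaming algebra. Over `(x, ι)` a variable `a` has two displayed
interpretations: `S_ι (var a)` and the given `var•`. The variables of the algebra are those on which
the two agree (`goodVar`). The extension of `(x, ι)` by `A` is the extension of `x` in the
renamings, with `ι` extended by `var•` of the generic variable (`exists_extension`): this choice
makes the generic variable good, and goodness of any other variable is what makes its classifying
renaming commute with `ι`. Biinitiality of the renamings gives a morphism into this algebra;
transporting its `ι` along the 2-cell to the identity gives `α`, and the required equation says that
every variable lands among the good ones. -/

namespace RelativeInduction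

/-! ### Context extensions -/

section Extensions

variable {C : Type o₁} [Category.{h₁} C] {D : Type o₂} [Category.{h₂} D]

namespace IsExtension

variable {X Y : Cᵒᵖ ⥤ Type t} {π : Y ⟶ X} {Γ : C} {x : X.obj (op Γ)} {E : C} {p : E ⟶ Γ}
  {q : Y.obj (op E)}

/-- The morphism into a context extension with given components. -/
noncomputable def lift (hE : IsExtension π x p q) {Δ : C} (σ : Δ ⟶ Γ) (y : Y.obj (op Δ))
    (h : ap π y = res X σ x) : Δ ⟶ E :=
  (hE.existsUnique_lift σ y h).choose

theorem lift_p (hE : IsExtension π x p q) {Δ : C} (σ : Δ ⟶ Γ) (y : Y.obj (op Δ))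
    (h : ap π y = res X σ x) : hE.lift σ y h ≫ p = σ :=
  (hE.existsUnique_lift σ y h).choose_spec.1.1

theorem lift_q (hE : IsExtension π x p q) {Δ : C} (σ : Δ ⟶ Γ) (y : Y.obj (op Δ))
    (h : ap π y = res X σ x) : res Y (hE.lift σ y h) q = y :=
  (hE.existsUnique_lift σ y h).choose_spec.1.2

theorem isOver_comp (hE : IsExtension π x p q) {Δ : C} (τ : Δ ⟶ E) :
    ap π (res Y τ q) = res X (τ ≫ p) x := by
  rw [ap_res, hE.isOver, res_comp]

theorem hom_ext (hE : IsExtension π x p q) {Δ : C} {τ τ' : Δ ⟶ E} (hp : τ ≫ p = τ' ≫ p)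
    (hq : res Y τ q = res Y τ' q) : τ = τ' :=
  (hE.existsUnique_lift (τ' ≫ p) (res Y τ' q) (hE.isOver_comp τ')).unique ⟨hp, hq⟩ ⟨rfl, rfl⟩

theorem of_iso (hE : IsExtension π x p q) {E' : C} (e : E' ≅ E) :
    IsExtension π x (e.hom ≫ p) (res Y e.hom q) where
  isOver := hE.isOver_comp e.hom
  existsUnique_lift σ y h := by
    refine ⟨hE.lift σ y h ≫ e.inv, ⟨?_, ?_⟩, ?_⟩
    · simp [hE.lift_p]
    · rw [← res_comp, Category.assoc, e.inv_hom_id, Category.comp_id, hE.lift_q]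
    · rintro τ ⟨hp, hq⟩
      rw [← cancel_mono e.hom, Category.assoc, e.inv_hom_id, Category.comp_id]
      refine hE.hom_ext ?_ ?_
      · rw [Category.assoc, hp, hE.lift_p]
      · rw [res_comp, hq, hE.lift_q]

theorem exists_iso (hE : IsExtension π x p q) {E' : C} {p' : E' ⟶ Γ} {q' : Y.obj (op E')}
    (hE' : IsExtension π x p' q') : ∃ e : E' ≅ E, e.hom ≫ p = p' ∧ res Y e.hom q = q' := by
  refine ⟨⟨hE.lift p' q' hE'.isOver, hE'.lift p q hE.isOver, ?_, ?_⟩, hE.lift_p _ _ hE'.isOver,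
    hE.lift_q _ _ hE'.isOver⟩
  · refine hE'.hom_ext ?_ ?_
    · simp [lift_p]
    · rw [res_comp, lift_q, lift_q, res_id]
  · refine hE.hom_ext ?_ ?_
    · simp [lift_p]
    · rw [res_comp, lift_q, lift_q, res_id]

end IsExtension

/-- Context extensions of the same data are isomorphic, so one well-chosen extension for each type
is enough to test preservation. All preservation statements for the constructed algebras are reduced
to explicit extensions in this way. -/
theorem PreservesExtensions.of_exists {F : C ⥤ D} {X Y : Cᵒᵖ ⥤ Type t} {π : Y ⟶ X}
    {X' Y' : Dᵒᵖ ⥤ Type t} {π' : Y' ⟶ X'} {f : X ⟶ F.op ⋙ X'} {g : Y ⟶ F.op ⋙ Y'}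
    (H : ∀ (Γ : C) (x : X.obj (op Γ)), ∃ (E : C) (p : E ⟶ Γ) (q : Y.obj (op E)),
      IsExtension π x p q ∧ IsExtension π' (act f x) (F.map p) (act g q)) :
    PreservesExtensions F π π' f g := by
  intro Γ x E' p' q' hE'
  obtain ⟨E, p, q, hE, hFE⟩ := H Γ x
  obtain ⟨e, rfl, rfl⟩ := hE.exists_iso hE'
  have := hFE.of_iso (F.mapIso e)
  rw [act_res, F.map_comp]
  exact this

theorem PreservesTerminal.of_exists {F : C ⥤ D} {X : C} (hX : IsTerminal X)
    (hFX : IsTerminal (F.obj X)) : PreservesTerminal F := fun _ ⟨hX'⟩ =>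
  ⟨hFX.ofIso (F.mapIso (hX.uniqueUpToIso hX'))⟩

end Extensions

/-! ### Images of families -/

namespace Fam

variable {C : Type o₁} [Category.{h₁} C] {T : TypeFamily.{t} C} {Γ : C} {A : T.Ty.obj (op Γ)}
  {X : Cᵒᵖ ⥤ Type t}

/-- Replaces rewriting in the arguments of a family, which is blocked by the typing proof that
depends on them. -/
theorem val_congr (B : Fam T A X) {Δ : C} {σ σ' : Δ ⟶ Γ} {a a' : T.Tm.obj (op Δ)}
    (h : ap T.tp a = res T.Ty σ A) (hσ : σ = σ') (ha : a = a') :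
    B.val σ a h = B.val σ' a' (by rw [← hσ, ← ha, h]) := by
  subst hσ ha
  rfl

theorem eq_of_val {B B' : Fam T A X}
    (H : ∀ (Δ : C) (σ : Δ ⟶ Γ) (a : T.Tm.obj (op Δ)) (h : ap T.tp a = res T.Ty σ A),
      B.val σ a h = B'.val σ a h) : B = B' := by
  apply Fam.ext
  funext Δ σ a h
  exact H Δ σ a h

theorem at'_restrict (B : Fam T A X) {Δ : C} (σ : Δ ⟶ Γ) {A' : T.Ty.obj (op Δ)}
    (e : res T.Ty σ A = A') (a : T.Tm.obj (op Δ)) (h : ap T.tp a = A') :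
    (B.restrict σ e).at' a h = B.val σ a (h.trans e.symm) :=
  B.val_congr _ (Category.id_comp σ) rfl

theorem restrict_id (B : Fam T A X) (e : res T.Ty (𝟙 Γ) A = A) : B.restrict (𝟙 Γ) e = B :=
  eq_of_val fun _ _ _ _ => B.val_congr _ (Category.comp_id _) rfl

theorem restrict_restrict (B : Fam T A X) {Δ Θ : C} (σ : Δ ⟶ Γ) {A' : T.Ty.obj (op Δ)}
    (e : res T.Ty σ A = A') (τ : Θ ⟶ Δ) {A'' : T.Ty.obj (op Θ)} (e' : res T.Ty τ A' = A'') :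
    (B.restrict σ e).restrict τ e' =
      B.restrict (τ ≫ σ) (by rw [res_comp, e, e']) :=
  eq_of_val fun _ _ _ _ => B.val_congr _ (Category.assoc _ _ _) rfl

theorem res_at' (B : Fam T A X) (a : T.Tm.obj (op Γ)) (h : ap T.tp a = A) {Δ : C} (σ : Δ ⟶ Γ) :
    res X σ (B.at' a h) = B.val σ (res T.Tm σ a) (by rw [ap_res, h]) := by
  rw [at', B.val_res]
  exact B.val_congr _ (Category.comp_id _) rfl

end Fam

namespace FamilyMap

variable {C : Type o₁} [Category.{h₁} C] {D : Type o₂} [Category.{h₂} D] {F : C ⥤ D}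
  {T : TypeFamily.{t} C} {T' : TypeFamily.{t} D} {φ : FamilyMap F T T'} {Γ : C}
  {A : T.Ty.obj (op Γ)} {A' : T'.Ty.obj (op (F.obj Γ))} {X : Cᵒᵖ ⥤ Type t} {X' : Dᵒᵖ ⥤ Type t}
  {f : X ⟶ F.op ⋙ X'}

/-- The image of a family under a functor that preserves context extensions. -/
theorem existsUnique_matches (hT : IsLocallyRepresentable T.tp)
    (hφ : PreservesExtensions F T.tp T'.tp φ.ty φ.tm) (hA : act φ.ty A = A')
    (f : X ⟶ F.op ⋙ X') (B : Fam T A X) : ∃! B' : Fam T' A' X', φ.Matches hA f B B' := by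
  subst hA
  obtain ⟨E, p, q, hE⟩ := hT Γ A
  have hE' := hφ A p q hE
  -- A family is determined by its value at the generic element of the context extension. As `F`
  -- preserves the extension, the image family must take the value `F (B p q)` at `(F p, F q)`, and
  -- every other value is a restriction of this one.
  refine ⟨⟨fun σ a h => res X' (hE'.lift σ a h) (act f (B.val p q hE.isOver)), ?_⟩, ?_, ?_⟩
  · intro Δ Θ τ σ a h
    rw [← res_comp]
    congr 1
    refine hE'.hom_ext ?_ ?_
    · rw [Category.assoc, IsExtension.lift_p, IsExtension.lift_p]
    · rw [res_comp, IsExtension.lift_q, IsExtension.lift_q]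
  · intro Δ σ a h
    have hl : hE'.lift (F.map σ) (act φ.tm a) (φ.tp_tm_eq rfl h) = F.map (hE.lift σ a h) := by
      refine hE'.hom_ext ?_ ?_
      · rw [IsExtension.lift_p, ← F.map_comp, IsExtension.lift_p]
      · rw [IsExtension.lift_q, ← act_res, IsExtension.lift_q]
    change res X' _ _ = _
    rw [hl, ← act_res, B.val_res]
    congr 1
    exact B.val_congr _ (hE.lift_p _ _ _) (hE.lift_q _ _ _)
  · intro B' hB'
    refine Fam.eq_of_val fun Δ σ a h => ?_
    change _ = res X' _ _
    rw [← hB' p q hE.isOver, B'.val_res]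
    exact B'.val_congr _ (hE'.lift_p _ _ _).symm (hE'.lift_q _ _ _).symm

theorem Matches.at' {hA : act φ.ty A = A'} {B : Fam T A X} {B' : Fam T' A' X'}
    (hB : φ.Matches hA f B B') (a : T.Tm.obj (op Γ)) (h : ap T.tp a = A)
    (h' : ap T'.tp (act φ.tm a) = A') : B'.at' (act φ.tm a) h' = act f (B.at' a h) :=
  (B'.val_congr _ (F.map_id Γ).symm rfl).trans (hB (𝟙 Γ) a (T.tp_id h))

/-- Supplies the typing hypotheses for the image of a boolean eliminator; the free `a'` allows for
images of `true` and `false` that are equal to the expected ones only propositionally. -/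
theorem Matches.tp_eq_at' {hA : act φ.ty A = A'} {B : Fam T A T.Ty} {B' : Fam T' A' T'.Ty}
    (hB : φ.Matches hA φ.ty B B') {s a : T.Tm.obj (op Γ)} {ha : ap T.tp a = A}
    (hs : ap T.tp s = B.at' a ha) {a' : T'.Tm.obj (op (F.obj Γ))} (e : act φ.tm a = a')
    (h' : ap T'.tp a' = A') : ap T'.tp (act φ.tm s) = B'.at' a' h' := by
  subst e
  rw [φ.tp_tm, hs, hB.at' a ha h']

end FamilyMap

/-! ### The total model of a displayed model with context extensions -/

namespace DispModel

variable {P : Type o₁} [Category.{h₁} P] {S : Type o₂} [Category.{h₂} S] {G : P ⥤ S}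
  {M : Model.{t} S} {D : DispModel G M}

namespace HasContextExtensions

variable (hD : D.HasContextExtensions)

section Base

variable {Γ : P} {A' : D.Ty.obj (op Γ)} {A : M.Ty.obj (op (G.obj Γ))} {X' : Pᵒᵖ ⥤ Type t}
  {X : Sᵒᵖ ⥤ Type t}

/-- The family of the base model over which a family of the displayed model lies. -/
noncomputable def baseFam (hA : act D.base.ty A' = A) (f : X' ⟶ G.op ⋙ X)
    (B' : Fam D.toTypeFamily A' X') : Fam M.toTypeFamily A X :=
  (FamilyMap.existsUnique_matches hD.rep hD.ext hA f B').choose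

theorem matches_baseFam (hA : act D.base.ty A' = A) (f : X' ⟶ G.op ⋙ X)
    (B' : Fam D.toTypeFamily A' X') : D.base.Matches hA f B' (hD.baseFam hA f B') :=
  (FamilyMap.existsUnique_matches hD.rep hD.ext hA f B').choose_spec.1

theorem matches_unique (hD : D.HasContextExtensions) {hA : act D.base.ty A' = A} {f : X' ⟶ G.op ⋙ X}
    {B' : Fam D.toTypeFamily A' X'} {B B₁ : Fam M.toTypeFamily A X}
    (hB : D.base.Matches hA f B' B) (hB₁ : D.base.Matches hA f B' B₁) : B = B₁ :=
  (FamilyMap.existsUnique_matches hD.rep hD.ext hA f B').unique hB hB₁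

theorem baseFam_eq {hA : act D.base.ty A' = A} {f : X' ⟶ G.op ⋙ X}
    {B' : Fam D.toTypeFamily A' X'} {B : Fam M.toTypeFamily A X}
    (hB : D.base.Matches hA f B' B) : hD.baseFam hA f B' = B :=
  hD.matches_unique (hD.matches_baseFam hA f B') hB

end Base

/-- The Π-types of the total model. -/
noncomputable def totalPi {Γ : P} (A' : D.Ty.obj (op Γ)) (B' : Fam D.toTypeFamily A' D.Ty) :
    D.Ty.obj (op Γ) :=
  D.Pi (hD.baseFam rfl D.base.ty B') A' rfl B' (hD.matches_baseFam rfl D.base.ty B')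

/-- The base family in `totalPi` is a choice, but a family lies over only one base family, so any
other witness gives the same result. The analogues for `lam` and `boolElim` serve the same purpose.
-/
theorem totalPi_eq {Γ : P} {A : M.Ty.obj (op (G.obj Γ))} (B : Fam M.toTypeFamily A M.Ty)
    (A' : D.Ty.obj (op Γ)) (hA : act D.base.ty A' = A) (B' : Fam D.toTypeFamily A' D.Ty)
    (hB : D.base.Matches hA D.base.ty B' B) : hD.totalPi A' B' = D.Pi B A' hA B' hB := by
  subst hA
  obtain rfl := hD.baseFam_eq hB
  rfl

/-- The abstractions of the total model. -/
noncomputable def totalLam {Γ : P} (A' : D.Ty.obj (op Γ)) (b' : Fam D.toTypeFamily A' D.Tm) :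
    D.Tm.obj (op Γ) :=
  D.lam (hD.baseFam rfl D.base.tm b') A' rfl b' (hD.matches_baseFam rfl D.base.tm b')

theorem totalLam_eq {Γ : P} {A : M.Ty.obj (op (G.obj Γ))} (b : Fam M.toTypeFamily A M.Tm)
    (A' : D.Ty.obj (op Γ)) (hA : act D.base.ty A' = A) (b' : Fam D.toTypeFamily A' D.Tm)
    (hb : D.base.Matches hA D.base.tm b' b) : hD.totalLam A' b' = D.lam b A' hA b' hb := by
  subst hA
  obtain rfl := hD.baseFam_eq hb
  rfl

/-- The eliminator of the booleans of the total model. -/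
noncomputable def totalBoolElim {Γ : P} (Q : Fam D.toTypeFamily (D.bool Γ) D.Ty)
    (t f b : D.Tm.obj (op Γ)) (ht : ap D.tp t = Q.at' (D.tt Γ) (D.tp_tt Γ))
    (hf : ap D.tp f = Q.at' (D.ff Γ) (D.tp_ff Γ)) (hb : ap D.tp b = D.bool Γ) :
    D.Tm.obj (op Γ) :=
  D.boolElim (hD.baseFam (D.base_bool Γ) D.base.ty Q) Q
    (hD.matches_baseFam (D.base_bool Γ) D.base.ty Q) t f b ht hf hb

theorem totalBoolElim_eq {Γ : P} (Q₀ : Fam M.toTypeFamily (M.bool (G.obj Γ)) M.Ty)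
    (Q : Fam D.toTypeFamily (D.bool Γ) D.Ty) (hQ : D.base.Matches (D.base_bool Γ) D.base.ty Q Q₀)
    (t f b : D.Tm.obj (op Γ)) (ht hf hb) :
    hD.totalBoolElim Q t f b ht hf hb = D.boolElim Q₀ Q hQ t f b ht hf hb := by
  obtain rfl := hD.baseFam_eq hQ
  rfl

/-- The total model of a displayed model with context extensions. -/
noncomputable def total : Model.{t} P where
  toTypeFamily := D.toTypeFamily
  hasTerminal := hD.hasTerminal
  rep := hD.rep
  Pi := hD.totalPi
  Pi_res σ A B := by
    rw [totalPi, D.Pi_res σ _ _ _ _ _ (by rw [act_res])]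
    exact (hD.totalPi_eq _ _ _ _ _).symm
  lam := hD.totalLam
  lam_res σ A b := by
    rw [totalLam, D.lam_res σ _ _ _ _ _ (by rw [act_res])]
    exact (hD.totalLam_eq _ _ _ _ _).symm
  tp_lam A b := by
    rw [totalLam, D.tp_lam]
    exact (hD.totalPi_eq _ _ _ _ _).symm
  lam_bijective {Γ} A' B' f' hf' := by
    -- The displayed bijection needs a term of `M` already presented as an abstraction: `f'` is
    -- first inverted in `M`, and then over the resulting `b`.
    obtain ⟨b, ⟨hbB, hbf⟩, hbu⟩ := M.lam_bijective (act D.base.ty A')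
      (hD.baseFam rfl D.base.ty B') (act D.base.tm f')
      (by rw [D.base.tp_tm, hf', totalPi, D.base_Pi])
    obtain ⟨b', ⟨hb'B, hb', hb'f⟩, hb'u⟩ := D.lam_bijective _ A' rfl B'
      (hD.matches_baseFam rfl D.base.ty B') b hbB f' hf' hbf.symm
    refine ⟨b', ⟨hb'B, (hD.totalLam_eq _ _ _ _ hb').trans hb'f⟩, ?_⟩
    rintro c' ⟨rfl, rfl⟩
    -- A competing `c'` lies over some family of `M`; uniqueness in `M` forces that family to be
    -- `b`, so displayed uniqueness over `b` applies.
    have hc := hD.matches_baseFam rfl D.base.tm c'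
    have hcb : hD.baseFam rfl D.base.tm c' = b :=
      hbu _ ⟨hD.matches_unique hc.mapTp (hD.matches_baseFam rfl D.base.ty _),
        by rw [totalLam, D.base_lam]⟩
    subst hcb
    exact hb'u c' ⟨rfl, hc, rfl⟩
  bool := D.bool
  bool_res := D.bool_res
  tt := D.tt
  tt_res := D.tt_res
  tp_tt := D.tp_tt
  ff := D.ff
  ff_res := D.ff_res
  tp_ff := D.tp_ff
  boolElim := hD.totalBoolElim
  tp_boolElim Q t f b ht hf hb := D.tp_boolElim _ _ _ _ _ _ _ _ _
  boolElim_res σ Q t f b ht hf hb ht' hf' hb' := by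
    rw [totalBoolElim, D.boolElim_res σ _ _ _ _ _ _ _ _ _ ht' hf' hb']
    exact (hD.totalBoolElim_eq _ _ _ _ _ _ _ _ _).symm
  boolElim_tt Q t f ht hf := D.boolElim_tt _ _ _ _ _ _ _
  boolElim_ff Q t f ht hf := D.boolElim_ff _ _ _ _ _ _ _

/-- The projection of the total model. -/
noncomputable def totalProj : ModelHom hD.total M where
  functor := G
  map := D.base
  terminal := hD.terminal
  ext := hD.ext
  Pi A' B' B hB := (congrArg (act D.base.ty) (hD.totalPi_eq B A' rfl B' hB)).trans
    (D.base_Pi B A' rfl B' hB)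
  lam A' b' b hb := (congrArg (act D.base.tm) (hD.totalLam_eq b A' rfl b' hb)).trans
    (D.base_lam b A' rfl b' hb)
  bool := D.base_bool
  tt := D.base_tt
  ff := D.base_ff
  boolElim Q Q₀ hQ t f b ht hf hb ht' hf' hb' :=
    (congrArg (act D.base.tm) (hD.totalBoolElim_eq Q₀ Q hQ t f b ht hf hb)).trans
      (D.base_boolElim Q₀ Q hQ t f b ht hf hb ht' hf' hb')

end HasContextExtensions

end DispModel

/-! ### Composition of morphisms of models -/

section Comp

variable {C₁ : Type o₁} [Category.{h₁} C₁] {C₂ : Type o₂} [Category.{h₂} C₂] {C₃ : Type o₃}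
  [Category.{h₃} C₃]

/-- The composite of two actions on types and terms. -/
def FamilyMap.comp {F : C₁ ⥤ C₂} {F' : C₂ ⥤ C₃} {T₁ : TypeFamily.{t} C₁} {T₂ : TypeFamily.{t} C₂}
    {T₃ : TypeFamily.{t} C₃} (φ : FamilyMap F T₁ T₂) (ψ : FamilyMap F' T₂ T₃) :
    FamilyMap (F ⋙ F') T₁ T₃ where
  ty := φ.ty ≫ Functor.whiskerLeft F.op ψ.ty
  tm := φ.tm ≫ Functor.whiskerLeft F.op ψ.tm
  tp_tm a := (ψ.tp_tm (act φ.tm a)).trans (congrArg (act ψ.ty) (φ.tp_tm a))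

variable {M₁ : Model.{t} C₁} {M₂ : Model.{t} C₂} {M₃ : Model.{t} C₃}

/-- A composite compares only the outer families, whereas preservation by each factor needs the
family in between. It is the image of `B` under `f`; its image under `g` agrees with `B₃` because
both are determined by their value at the image of the generic element of `A`. -/
theorem ModelHom.exists_matches_comp (f : ModelHom M₁ M₂) (g : ModelHom M₂ M₃) {Γ : C₁}
    {A : M₁.Ty.obj (op Γ)} {A₂ : M₂.Ty.obj (op (f.functor.obj Γ))}
    {A₃ : M₃.Ty.obj (op (g.functor.obj (f.functor.obj Γ)))} (h₂ : act f.map.ty A = A₂)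
    (h₃ : act g.map.ty A₂ = A₃) {X₁ : C₁ᵒᵖ ⥤ Type t} {X₂ : C₂ᵒᵖ ⥤ Type t} {X₃ : C₃ᵒᵖ ⥤ Type t}
    (k₁ : X₁ ⟶ f.functor.op ⋙ X₂) (k₂ : X₂ ⟶ g.functor.op ⋙ X₃)
    (B : Fam M₁.toTypeFamily A X₁) (B₃ : Fam M₃.toTypeFamily A₃ X₃)
    (h : ∀ ⦃Δ : C₁⦄ (σ : Δ ⟶ Γ) (a : M₁.Tm.obj (op Δ)) (h : ap M₁.tp a = res M₁.Ty σ A),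
      B₃.val (g.functor.map (f.functor.map σ)) (act g.map.tm (act f.map.tm a))
        (g.map.tp_tm_eq h₃ (f.map.tp_tm_eq h₂ h)) = act k₂ (act k₁ (B.val σ a h))) :
    ∃ B₂ : Fam M₂.toTypeFamily A₂ X₂, f.map.Matches h₂ k₁ B B₂ ∧ g.map.Matches h₃ k₂ B₂ B₃ := by
  subst h₂ h₃
  obtain ⟨B₂, hB₂, -⟩ := FamilyMap.existsUnique_matches M₁.rep f.ext rfl k₁ B
  obtain ⟨B₃', hB₃', -⟩ := FamilyMap.existsUnique_matches M₂.rep g.ext rfl k₂ B₂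
  refine ⟨B₂, hB₂, ?_⟩
  convert hB₃'
  obtain ⟨E, p, q, hE⟩ := M₁.rep Γ A
  have hE₃ := g.ext _ _ _ (f.ext A p q hE)
  refine Fam.eq_of_val fun Δ σ a ha => ?_
  -- Every value is a restriction of the one at the twice transported generic element.
  have key : ∀ B' : Fam M₃.toTypeFamily (act g.map.ty (act f.map.ty A)) X₃,
      B'.val σ a ha = res X₃ (hE₃.lift σ a ha) (B'.val _ _ hE₃.isOver) := fun B' => by
    rw [B'.val_res]
    exact B'.val_congr _ (hE₃.lift_p _ _ _).symm (hE₃.lift_q _ _ _).symm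
  rw [key B₃, key B₃', h p q hE.isOver, hB₃' _ _ (f.ext A p q hE).isOver, hB₂ p q hE.isOver]

/-- The composite of two morphisms of models. -/
def ModelHom.comp (f : ModelHom M₁ M₂) (g : ModelHom M₂ M₃) : ModelHom M₁ M₃ where
  functor := f.functor ⋙ g.functor
  map := f.map.comp g.map
  terminal X hX := g.terminal _ (f.terminal X hX)
  ext _ _ _ _ _ h := g.ext _ _ _ (f.ext _ _ _ h)
  Pi A B B₃ h := by
    obtain ⟨B₂, hf, hg⟩ := f.exists_matches_comp g rfl rfl f.map.ty g.map.ty B B₃ h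
    exact (congrArg (act g.map.ty) (f.Pi A B B₂ hf)).trans (g.Pi _ B₂ B₃ hg)
  lam A B B₃ h := by
    obtain ⟨B₂, hf, hg⟩ := f.exists_matches_comp g rfl rfl f.map.tm g.map.tm B B₃ h
    exact (congrArg (act g.map.tm) (f.lam A B B₂ hf)).trans (g.lam _ B₂ B₃ hg)
  bool Γ := (congrArg (act g.map.ty) (f.bool Γ)).trans (g.bool _)
  tt Γ := (congrArg (act g.map.tm) (f.tt Γ)).trans (g.tt _)
  ff Γ := (congrArg (act g.map.tm) (f.ff Γ)).trans (g.ff _)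
  boolElim {Γ} Q Q₃ h t e b ht hf hb ht' hf' hb' := by
    obtain ⟨Q₂, hfQ, hgQ⟩ := f.exists_matches_comp g (f.bool Γ) (g.bool _) f.map.ty g.map.ty Q Q₃ h
    exact (congrArg (act g.map.tm) (f.boolElim Q Q₂ hfQ t e b ht hf hb
      (hfQ.tp_eq_at' ht (f.tt Γ) _) (hfQ.tp_eq_at' hf (f.ff Γ) _)
      (by rw [f.map.tp_tm, hb, f.bool]))).trans (g.boolElim Q₂ Q₃ hgQ _ _ _ _ _ _ ht' hf' hb')

end Comp

/-! ### Models with a lifted set of objects -/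

section Lift

attribute [local instance] uliftCategory

variable {C : Type o₁} [Category.{h₁} C]

/-- The restriction of a type family to the lifted category. -/
def TypeFamily.ulift (T : TypeFamily.{t} C) : TypeFamily.{t} (ULift.{o₂} C) where
  Ty := ULift.downFunctor.op ⋙ T.Ty
  Tm := ULift.downFunctor.op ⋙ T.Tm
  tp := Functor.whiskerLeft ULift.downFunctor.op T.tp

/-- A family over the lifted category, as a family over the category. -/
def Fam.down {T : TypeFamily.{t} C} {Γ : ULift.{o₂} C} {A : T.Ty.obj (op Γ.down)}
    {X : Cᵒᵖ ⥤ Type t}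
    (B : Fam (TypeFamily.ulift.{t, h₁, o₁, o₂} T) (Γ := Γ) A (ULift.downFunctor.op ⋙ X)) :
    Fam T A X where
  val {Δ} σ a h := B.val (Δ := ⟨Δ⟩) σ a h
  val_res {Δ Θ} τ σ a h := B.val_res (Δ := ⟨Δ⟩) (Θ := ⟨Θ⟩) τ σ a h

/-- A family over the category, as a family over the lifted category. -/
def Fam.up {T : TypeFamily.{t} C} {Γ : ULift.{o₂} C} {A : T.Ty.obj (op Γ.down)}
    {X : Cᵒᵖ ⥤ Type t} (B : Fam T A X) :
    Fam (TypeFamily.ulift.{t, h₁, o₁, o₂} T) (Γ := Γ) A (ULift.downFunctor.op ⋙ X) where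
  val {Δ} σ a h := B.val (Δ := Δ.down) σ a h
  val_res {Δ Θ} τ σ a h := B.val_res (Δ := Δ.down) (Θ := Θ.down) τ σ a h

/-- Terminal objects are terminal in the lifted category. -/
def isTerminalUp {X : C} (hX : IsTerminal X) : IsTerminal (ULift.up.{o₂} X) :=
  IsTerminal.ofUniqueHom (fun Y => hX.from Y.down) fun Y m => hX.hom_ext (Y := Y.down) m _

/-- The model with a lifted set of objects. -/
def Model.ulift (M : Model.{t} C) : Model.{t} (ULift.{o₂} C) where
  toTypeFamily := M.toTypeFamily.ulift
  hasTerminal := by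
    have := M.hasTerminal
    exact (isTerminalUp terminalIsTerminal).hasTerminal
  rep Γ A := by
    obtain ⟨E, p, q, hE⟩ := M.rep Γ.down A
    exact ⟨⟨E⟩, p, q, hE.isOver, fun {Δ} σ y h => hE.existsUnique_lift (Δ := Δ.down) σ y h⟩
  Pi A B := M.Pi A B.down
  Pi_res σ A B := M.Pi_res σ A B.down
  lam A b := M.lam A b.down
  lam_res σ A b := M.lam_res σ A b.down
  tp_lam A b := M.tp_lam A b.down
  lam_bijective A B f h := by
    obtain ⟨b, ⟨hb, hbf⟩, hbu⟩ := M.lam_bijective A B.down f h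
    refine ⟨b.up, ⟨congrArg Fam.up hb, hbf⟩, ?_⟩
    rintro b' ⟨hb', hbf'⟩
    exact congrArg Fam.up (hbu b'.down ⟨congrArg Fam.down hb', hbf'⟩)
  bool Γ := M.bool Γ.down
  bool_res σ := M.bool_res σ
  tt Γ := M.tt Γ.down
  tt_res σ := M.tt_res σ
  tp_tt Γ := M.tp_tt Γ.down
  ff Γ := M.ff Γ.down
  ff_res σ := M.ff_res σ
  tp_ff Γ := M.tp_ff Γ.down
  boolElim P t f b ht hf hb := M.boolElim P.down t f b ht hf hb
  tp_boolElim P t f b ht hf hb := M.tp_boolElim P.down t f b ht hf hb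
  boolElim_res σ P t f b ht hf hb ht' hf' hb' := M.boolElim_res σ P.down t f b ht hf hb ht' hf' hb'
  boolElim_tt P t f ht hf := M.boolElim_tt P.down t f ht hf
  boolElim_ff P t f ht hf := M.boolElim_ff P.down t f ht hf

/-- The actions of the lifting morphism on types and terms are identities, so matching families
differ only by the lifting. This makes its preservation of the operations immediate. -/
theorem Model.matches_ulift_eq {M : Model.{t} C} {Γ : C} {A : M.Ty.obj (op Γ)} {X : Cᵒᵖ ⥤ Type t}
    {B : Fam M.toTypeFamily A X}
    {B' : Fam (TypeFamily.ulift.{t, h₁, o₁, o₂} M.toTypeFamily) (Γ := ⟨Γ⟩) A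
      (ULift.downFunctor.op ⋙ X)}
    (h : ∀ ⦃Δ : C⦄ (σ : Δ ⟶ Γ) (a : M.Tm.obj (op Δ)) (h : ap M.tp a = res M.Ty σ A),
      B'.val (Δ := ⟨Δ⟩) σ a h = B.val σ a h) : B'.down = B :=
  Fam.eq_of_val fun _ σ a ha => h σ a ha

/-- The morphism from a model to the model with a lifted set of objects. -/
def Model.upHom (M : Model.{t} C) : ModelHom M (Model.ulift.{t, h₁, o₁, o₂} M) where
  functor := ULift.upFunctor
  map := { ty := 𝟙 M.Ty, tm := 𝟙 M.Tm, tp_tm := fun _ => rfl }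
  terminal X hX := hX.map isTerminalUp
  ext _ _ _ _ _ h := ⟨h.isOver, fun {Δ} σ y h' => h.existsUnique_lift (Δ := Δ.down) σ y h'⟩
  Pi A B B' h := congrArg (M.Pi A) (Model.matches_ulift_eq h).symm
  lam A B B' h := congrArg (M.lam A) (Model.matches_ulift_eq h).symm
  bool _ := rfl
  tt _ := rfl
  ff _ := rfl
  boolElim Q Q' h t f b ht hf hb ht' hf' hb' := by
    obtain rfl := Model.matches_ulift_eq h
    rfl

end Lift

/-! ### Sections of displayed models over a biinitial model -/

section Section

attribute [local instance] uliftCategory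

variable {P : Type o₁} [Category.{h₁} P] {S : Type o₂} [Category.{h₂} S] {G : P ⥤ S}
  {M : Model.{t} S} {D : DispModel G M}

/-- A section up to isomorphism of the projection of the total model is a section of the
displayed model. -/
noncomputable def DispModel.HasContextExtensions.sectionOfHom (hD : D.HasContextExtensions)
    (f : ModelHom M hD.total) (iso : f.functor ⋙ G ≅ 𝟭 S)
    (base_ty : ∀ {Γ : S} (A : M.Ty.obj (op Γ)),
      act D.base.ty (act f.map.ty A) = res M.Ty (iso.hom.app Γ) A)
    (base_tm : ∀ {Γ : S} (a : M.Tm.obj (op Γ)),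
      act D.base.tm (act f.map.tm a) = res M.Tm (iso.hom.app Γ) a) : DispSection D where
  functor := f.functor
  iso := iso
  map := f.map
  base_ty := base_ty
  base_tm := base_tm
  terminal := f.terminal
  ext := f.ext
  Pi A B B' h hB := (f.Pi A B B' h).trans (hD.totalPi_eq _ _ _ _ hB)
  lam A b b' h hb := (f.lam A b b' h).trans (hD.totalLam_eq _ _ _ _ hb)
  bool := f.bool
  tt := f.tt
  ff := f.ff
  boolElim Q Q' h hQ t e b ht hf hb ht' hf' hb' :=
    (f.boolElim Q Q' h t e b ht hf hb ht' hf' hb').trans (hD.totalBoolElim_eq _ _ hQ _ _ _ _ _ _)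

/-- The morphism `f` into the total model, followed by the projection, is an endomorphism of `M`,
hence isomorphic to the identity. The compatibility of the 2-cell with types and terms says exactly
that the actions of `f` lie over the identity. -/
theorem Model.IsBiinitial.nonempty_dispSection {S : Type u} [Category.{u} S] {M : Model.{u} S}
    (hM : Model.IsBiinitial.{u, u, u, u + 1, u} M) {P : Type (u + 1)} [Category.{u} P] {G : P ⥤ S}
    {D : DispModel G M} (hD : D.HasContextExtensions) : Nonempty (DispSection D) := by
  obtain ⟨f⟩ := (hM P hD.total).1
  -- The biinitiality hypothesis concerns targets with objects in `Type (u + 1)`, while `S` is in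
  -- `Type u`. The endomorphism and the identity are therefore compared after lifting the objects of
  -- `S`, and the isomorphism is then lowered.
  obtain ⟨θ, hθ, -⟩ := (hM (ULift.{u + 1} S) M.ulift).2 ((f.comp hD.totalProj).comp M.upHom) M.upHom
  exact ⟨hD.sectionOfHom f (Functor.isoWhiskerRight θ ULift.downFunctor) hθ.ty hθ.tm⟩

end Section

/-! ### The renaming algebra of a displayed inserter -/

namespace Inserter

variable {S : Type u} [Category.{u} S] {M : Model.{u} S} {R : Type u} [Category.{u} R]

/-! ### Naturality of `S_ι` over the inserter. -/

section Restriction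

variable {F : R ⥤ S} {D : DispModel F M} {𝓕 : Factorization D} {S₀ : DispSection 𝓕.disp}

theorem map_sTy (X : Inserter 𝓕 S₀) (A : M.Ty.obj (op (F.obj X.pt))) :
    act 𝓕.map.ty (X.sTy A) = res 𝓕.disp.Ty X.ι (act S₀.map.ty A) :=
  (Equiv.ofBijective _ (𝓕.bij_ty X.pt)).apply_symm_apply _

theorem map_sTm (X : Inserter 𝓕 S₀) (a : M.Tm.obj (op (F.obj X.pt))) :
    act 𝓕.map.tm (X.sTm a) = res 𝓕.disp.Tm X.ι (act S₀.map.tm a) :=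
  (Equiv.ofBijective _ (𝓕.bij_tm X.pt)).apply_symm_apply _

/-- `Y` is injective on displayed terms, so equations in `D` can be checked in the model with
context extensions, where `S₀` lives. -/
theorem sTm_eq_iff (X : Inserter 𝓕 S₀) (a : M.Tm.obj (op (F.obj X.pt))) (a' : D.Tm.obj (op X.pt)) :
    X.sTm a = a' ↔ res 𝓕.disp.Tm X.ι (act S₀.map.tm a) = act 𝓕.map.tm a' := by
  rw [← map_sTm]
  exact ((𝓕.bij_tm X.pt).1.eq_iff (a := X.sTm a) (b := a')).symm

/-- After applying `Y`, this is the commutation of `θ` with the two `ι`'s. -/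
theorem res_sTm {X X' : Inserter 𝓕 S₀} (θ : X ⟶ X') (a : M.Tm.obj (op (F.obj X'.pt))) :
    X.sTm (res M.Tm (F.map θ.hom) a) = res D.Tm θ.hom (X'.sTm a) := by
  rw [sTm_eq_iff, act_res, act_res, map_sTm, ← res_comp, ← res_comp, θ.comm]

theorem hom_ext {X X' : Inserter 𝓕 S₀} {θ θ' : X ⟶ X'} (h : θ.hom = θ'.hom) : θ = θ' :=
  Hom.ext h

end Restriction

/-! ### Good variables and their context extensions. -/

variable {𝓡 : RenamingAlgebra M R} {D : DispModel 𝓡.F M} {𝓕 : Factorization D}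
  {S₀ : DispSection 𝓕.disp} (var' : VarInterpretation 𝓡 𝓕 S₀)

theorem val_congr (X : Inserter 𝓕 S₀) {A A' : M.Ty.obj (op (𝓡.F.obj X.pt))} {y : R}
    {ρ ρ' : y ⟶ X.pt} {a a' : 𝓡.Var.obj (op y)} (h : act 𝓡.vtp a = res M.Ty (𝓡.F.map ρ) A)
    (hA : A = A') (hρ : ρ = ρ') (ha : a = a') :
    var'.val X A ρ a h = var'.val X A' ρ' a' (by rw [← hA, ← hρ, ← ha, h]) := by
  subst hA hρ ha
  rfl

/-- The displayed interpretation of a variable over the object of the inserter itself. -/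
def interp (X : Inserter 𝓕 S₀) (a : 𝓡.Var.obj (op X.pt)) : D.Tm.obj (op X.pt) :=
  var'.val X (act 𝓡.vtp a) (𝟙 X.pt) a (𝓡.vtp_id a)

/-- Naturality of `var•` in the object of the inserter. It trades the interpretation over an
extended object for one over the original object, which is available before `ι` has been extended.
-/
theorem interp_res {X X' : Inserter 𝓕 S₀} (θ : X ⟶ X') (A : M.Ty.obj (op (𝓡.F.obj X'.pt)))
    (a : 𝓡.Var.obj (op X.pt)) (h : act 𝓡.vtp a = res M.Ty (𝓡.F.map θ.hom) A) :
    interp var' X a = var'.val X' A θ.hom a h := by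
  have h' : act 𝓡.vtp a = res M.Ty (𝓡.F.map (𝟙 X.pt)) (res M.Ty (𝓡.F.map θ.hom) A) := by
    rw [← h]
    exact 𝓡.vtp_id a
  have h'' : act 𝓡.vtp a = res M.Ty (𝓡.F.map (𝟙 X.pt ≫ θ.hom)) A := by
    rw [Category.id_comp, h]
  rw [interp, val_congr var' X _ h rfl rfl, var'.val_map θ A (𝟙 X.pt) a h' h'']
  exact val_congr var' X' _ rfl (Category.id_comp _) rfl

theorem res_interp {X X' : Inserter 𝓕 S₀} (θ : X ⟶ X') (a : 𝓡.Var.obj (op X'.pt)) :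
    res D.Tm θ.hom (interp var' X' a) = interp var' X (res 𝓡.Var θ.hom a) := by
  have h : act 𝓡.vtp (res 𝓡.Var θ.hom a) = res M.Ty (𝓡.F.map θ.hom) (act 𝓡.vtp a) :=
    act_res 𝓡.vtp θ.hom a
  rw [interp_res var' θ (act 𝓡.vtp a) _ h, interp,
    var'.val_res _ _ θ.hom (𝟙 _) a _ (by rw [Category.comp_id, h])]
  exact val_congr var' X' _ rfl (Category.comp_id _) rfl

/-- The variable `a` over `X` is sent to its displayed interpretation. -/
def IsGood (X : Inserter 𝓕 S₀) (a : 𝓡.Var.obj (op X.pt)) : Prop :=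
  X.sTm (act 𝓡.var a) = interp var' X a

/-- Both interpretations of variables are natural over the inserter, so their equalizer is a
subpresheaf. -/
theorem IsGood.res {X X' : Inserter 𝓕 S₀} (θ : X ⟶ X') {a : 𝓡.Var.obj (op X'.pt)}
    (h : IsGood var' X' a) : IsGood var' X (res 𝓡.Var θ.hom a) := by
  rw [IsGood, act_res, res_sTm, h, res_interp]

/-- The presheaf of the variables that are sent to their displayed interpretations. -/
def goodVar : (Inserter 𝓕 S₀)ᵒᵖ ⥤ Type u where
  obj X := {a : 𝓡.Var.obj (op X.unop.pt) // IsGood var' X.unop a}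
  map θ := TypeCat.ofHom fun a => ⟨RelativeInduction.res 𝓡.Var θ.unop.hom a.1, a.2.res var' θ.unop⟩
  map_id X := by
    ext a
    exact res_id 𝓡.Var a.1
  map_comp θ θ' := by
    ext a
    exact res_comp 𝓡.Var θ'.unop.hom θ.unop.hom a.1

/-- The inclusion of the good variables. -/
def goodIncl : goodVar var' ⟶ (proj 𝓕 S₀).op ⋙ 𝓡.Var where
  app X := TypeCat.ofHom fun a => a.1

/-- The types of the good variables. -/
def goodVtp : goodVar var' ⟶ (proj 𝓕 S₀ ⋙ 𝓡.F).op ⋙ M.Ty :=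
  goodIncl var' ≫ Functor.whiskerLeft (proj 𝓕 S₀).op 𝓡.vtp

/-- Since `F` and `S₀` preserve context extensions, a morphism into `S₀ (F E)` is a pair of a
morphism into `S₀ (F X.pt)` and a displayed term. The new `ι` pairs the old one with `var•` of the
generic variable. -/
theorem exists_extension (X : Inserter 𝓕 S₀) (A : M.Ty.obj (op (𝓡.F.obj X.pt))) :
    ∃ (X' : Inserter 𝓕 S₀) (θ : X' ⟶ X) (q : (goodVar var').obj (op X')),
      IsExtension (goodVtp var') A θ q ∧ IsExtension 𝓡.vtp A θ.hom q.1 := by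
  obtain ⟨E, p, q, hE⟩ := 𝓡.rep X.pt A
  have hq : act 𝓡.vtp q = res M.Ty (𝓡.F.map p) A := hE.isOver
  have hFE := 𝓡.ext A p q hE
  change IsExtension M.tp A (𝓡.F.map p) (act 𝓡.var q) at hFE
  have hSE := S₀.ext A (𝓡.F.map p) (act 𝓡.var q) hFE
  have hlift : ap 𝓕.disp.tp (act 𝓕.map.tm (var'.val X A p q hq)) =
      res 𝓕.disp.Ty (𝓕.Y.map p ≫ X.ι) (act S₀.map.ty A) := by
    rw [𝓕.map.tp_tm, var'.tp_val, act_res, map_sTy, res_comp]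
  let ι := hSE.lift _ _ hlift
  have hιp : ι ≫ S₀.functor.map (𝓡.F.map p) = 𝓕.Y.map p ≫ X.ι := hSE.lift_p _ _ hlift
  have hιq : res 𝓕.disp.Tm ι (act S₀.map.tm (act 𝓡.var q)) =
      act 𝓕.map.tm (var'.val X A p q hq) := hSE.lift_q _ _ hlift
  -- Being over the identity is tested in the base extension: the first component uses that `X.ι` is
  -- over the identity, the second that `var•` lies over `var q`.
  have hι : 𝓕.G.map ι ≫ S₀.iso.hom.app (𝓡.F.obj E) = 𝓕.fac.hom.app E := by
    refine hFE.hom_ext ?_ ?_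
    · have n₁ := S₀.iso.hom.naturality (𝓡.F.map p)
      have n₂ := 𝓕.fac.hom.naturality p
      simp only [Functor.comp_map, Functor.id_map] at n₁ n₂
      rw [Category.assoc, ← n₁, ← Category.assoc, ← 𝓕.G.map_comp, hιp, 𝓕.G.map_comp,
        Category.assoc, X.isOver, n₂]
    · rw [res_comp, ← S₀.base_tm, ← act_res, hιq, 𝓕.base_tm, var'.base_val]
  let X' : Inserter 𝓕 S₀ := ⟨E, ι, hι⟩
  let θ : X' ⟶ X := ⟨p, hιp.symm⟩
  -- The second component of `ι` was chosen to make this true.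
  have hgood : IsGood var' X' q := by
    rw [IsGood, interp_res var' θ A q hq, sTm_eq_iff]
    exact hιq
  refine ⟨X', θ, ⟨q, hgood⟩, ⟨hE.isOver, ?_⟩, hE⟩
  intro Z σ a ha
  change act 𝓡.vtp a.1 = res M.Ty (𝓡.F.map σ.hom) A at ha
  let τ := hE.lift σ.hom a.1 ha
  have hτp : τ ≫ p = σ.hom := hE.lift_p _ _ ha
  have hτq : res 𝓡.Var τ q = a.1 := hE.lift_q _ _ ha
  -- The classifying renaming `τ` of `a` is a morphism of the inserter: on the second component,
  -- commutation is the equality of `var• a` and `S_ι (var a)`, that is, goodness of `a`.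
  have hτ : 𝓕.Y.map τ ≫ ι = Z.ι ≫ S₀.functor.map (𝓡.F.map τ) := by
    refine hSE.hom_ext ?_ ?_
    · rw [Category.assoc, hιp, Category.assoc, ← S₀.functor.map_comp, ← 𝓡.F.map_comp, hτp,
        ← σ.comm, ← Category.assoc, ← 𝓕.Y.map_comp, hτp]
    · rw [res_comp, hιq, res_comp, ← act_res, ← act_res, ← act_res, hτq, ← map_sTm, a.2,
        interp_res var' σ A a.1 ha, var'.val_res X A τ p q hq (by rw [hτp, hτq, ha])]
      congr 1
      exact val_congr var' X _ rfl hτp hτq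
  refine ⟨⟨τ, hτ⟩, ⟨hom_ext hτp, Subtype.ext hτq⟩, ?_⟩
  rintro τ' ⟨hp, hq'⟩
  refine hom_ext (hE.hom_ext ?_ ?_)
  · exact (congrArg Hom.hom hp).trans hτp.symm
  · exact (congrArg Subtype.val hq').trans hτq.symm

/-- `S₀ (F ⊤)` is terminal, so `ι` and every commutation condition into it are unique. -/
theorem exists_terminal : ∃ X : Inserter 𝓕 S₀, Nonempty (IsTerminal X) ∧
    Nonempty (IsTerminal X.pt) := by
  have := 𝓡.hasTerminal
  have hT : IsTerminal (⊤_ R) := terminalIsTerminal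
  obtain ⟨hF⟩ := 𝓡.terminal _ ⟨hT⟩
  obtain ⟨hS⟩ := S₀.terminal _ ⟨hF⟩
  refine ⟨⟨⊤_ R, hS.from _, hF.hom_ext _ _⟩, ⟨IsTerminal.ofUniqueHom
    (fun Z => ⟨hT.from Z.pt, hS.hom_ext _ _⟩) fun Z m => hom_ext (hT.hom_ext _ _)⟩, ⟨hT⟩⟩

/-- The renaming algebra on the displayed inserter whose variables are the variables that are sent
to their displayed interpretations. -/
def algebra : RenamingAlgebra M (Inserter 𝓕 S₀) where
  F := proj 𝓕 S₀ ⋙ 𝓡.F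
  hasTerminal := by
    obtain ⟨X, ⟨hX⟩, -⟩ := exists_terminal (𝓕 := 𝓕) (S₀ := S₀)
    exact hX.hasTerminal
  terminal := by
    obtain ⟨X, ⟨hX⟩, hR⟩ := exists_terminal (𝓕 := 𝓕) (S₀ := S₀)
    obtain ⟨hF⟩ := 𝓡.terminal _ hR
    exact PreservesTerminal.of_exists hX hF
  Var := goodVar var'
  vtp := goodVtp var'
  rep X A := by
    obtain ⟨X', θ, q, h, -⟩ := exists_extension var' X A
    exact ⟨X', θ, q, h⟩
  var := goodIncl var' ≫ Functor.whiskerLeft (proj 𝓕 S₀).op 𝓡.var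
  tp_var a := 𝓡.tp_var a.1
  ext := PreservesExtensions.of_exists fun X A => by
    obtain ⟨X', θ, q, h, h'⟩ := exists_extension var' X A
    exact ⟨X', θ, q, h, 𝓡.ext A θ.hom q.1 h'⟩

/-- The projection of the displayed inserter as a morphism of renaming algebras. -/
def algebraProj : RenamingHom (algebra var') 𝓡 where
  functor := proj 𝓕 S₀
  iso := Iso.refl _
  onVar := goodIncl var'
  vtp_onVar _ := (res_id M.Ty _).symm
  var_onVar _ := (res_id M.Tm _).symm
  terminal := by
    obtain ⟨X, ⟨hX⟩, ⟨hR⟩⟩ := exists_terminal (𝓕 := 𝓕) (S₀ := S₀)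
    exact PreservesTerminal.of_exists hX hR
  ext := PreservesExtensions.of_exists fun X A => by
    obtain ⟨X', θ, q, h, h'⟩ := exists_extension var' X A
    refine ⟨X', θ, q, h, ?_⟩
    have : act (Functor.whiskerRight (NatTrans.op (Iso.refl (proj 𝓕 S₀ ⋙ 𝓡.F)).hom) M.Ty)
      (Γ := X) (F := proj 𝓕 S₀) (X' := 𝓡.F.op ⋙ M.Ty) A = A := res_id M.Ty A
    erw [this]
    exact h'

end Inserter

/-! ### Identities and composites of renaming morphisms, and the relative section. -/

/-- The identity morphism of a renaming algebra. -/
def RenamingHom.id {S : Type o₂} [Category.{h₂} S] {M : Model.{t} S} {R : Type o₁}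
    [Category.{h₁} R] (𝓡 : RenamingAlgebra M R) : RenamingHom 𝓡 𝓡 where
  functor := 𝟭 R
  iso := 𝓡.F.leftUnitor
  onVar := 𝟙 𝓡.Var
  vtp_onVar _ := (res_id M.Ty _).symm
  var_onVar _ := (res_id M.Tm _).symm
  terminal _ h := h
  ext Γ A E p q h := by
    have : act (Functor.whiskerRight (NatTrans.op 𝓡.F.leftUnitor.hom) M.Ty)
      (Γ := Γ) (F := 𝟭 R) (X' := 𝓡.F.op ⋙ M.Ty) A = A := res_id M.Ty A
    erw [this]
    exact h

/-- The composite of two morphisms of renaming algebras. -/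
def RenamingHom.comp {S : Type o₂} [Category.{h₂} S] {M : Model.{t} S} {R₁ R₂ R₃ : Type o₁}
    [Category.{h₁} R₁] [Category.{h₁} R₂] [Category.{h₁} R₃] {𝓡₁ : RenamingAlgebra M R₁}
    {𝓡₂ : RenamingAlgebra M R₂} {𝓡₃ : RenamingAlgebra M R₃} (f : RenamingHom 𝓡₁ 𝓡₂)
    (g : RenamingHom 𝓡₂ 𝓡₃) : RenamingHom 𝓡₁ 𝓡₃ where
  functor := f.functor ⋙ g.functor
  iso := Functor.isoWhiskerLeft f.functor g.iso ≪≫ f.iso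
  onVar := f.onVar ≫ Functor.whiskerLeft f.functor.op g.onVar
  vtp_onVar a := by
    refine (g.vtp_onVar (act f.onVar a)).trans ?_
    rw [f.vtp_onVar, ← res_comp]
    rfl
  var_onVar a := by
    refine (g.var_onVar (act f.onVar a)).trans ?_
    rw [f.var_onVar, ← res_comp]
    rfl
  terminal X h := g.terminal _ (f.terminal X h)
  ext Γ A E p q h := by
    have := g.ext _ _ _ (f.ext A p q h)
    have e : act (Functor.whiskerRight (NatTrans.op
        (Functor.isoWhiskerLeft f.functor g.iso ≪≫ f.iso).hom) M.Ty)
        (Γ := Γ) (F := f.functor ⋙ g.functor) (X' := 𝓡₃.F.op ⋙ M.Ty) A =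
        act (Functor.whiskerRight (NatTrans.op g.iso.hom) M.Ty) (F := g.functor)
          (X' := 𝓡₃.F.op ⋙ M.Ty)
          (act (Functor.whiskerRight (NatTrans.op f.iso.hom) M.Ty) (F := f.functor)
          (X' := 𝓡₂.F.op ⋙ M.Ty) A) := res_comp M.Ty _ _ A
    erw [e]
    exact this

/-- The morphism `h` from the renamings to the algebra of good variables is a section of the
projection only up to the 2-cell `θ`; conjugating by `θ` makes it a strict one. -/
theorem RenamingAlgebra.IsBiinitial.exists_relativeSection {S : Type u} [Category.{u} S]
    {M : Model.{u} S} {R : Type u} [Category.{u} R] {𝓡 : RenamingAlgebra M R}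
    (h𝓡 : 𝓡.IsBiinitial) {D : DispModel 𝓡.F M} {𝓕 : Factorization D} {S₀ : DispSection 𝓕.disp}
    (var' : VarInterpretation 𝓡 𝓕 S₀) :
    ∃ s : RelativeSection 𝓕 S₀, ∀ (x : R) (a : 𝓡.Var.obj (op x)),
      Inserter.IsGood var' (s.toInserter.obj x) a := by
  obtain ⟨h⟩ := (h𝓡 _ (Inserter.algebra var')).1
  obtain ⟨θ, hθ, -⟩ := (h𝓡 _ 𝓡).2 (h.comp (Inserter.algebraProj var')) (RenamingHom.id 𝓡)
  let i (x : R) : (h.functor.obj x).pt ≅ x := θ.app x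
  have hi {x y : R} (f : x ⟶ y) : (h.functor.map f).hom ≫ (i y).hom = (i x).hom ≫ f :=
    θ.hom.naturality f
  have hi' {x y : R} (f : x ⟶ y) : f ≫ (i y).inv = (i x).inv ≫ (h.functor.map f).hom :=
    θ.inv.naturality f
  let s : RelativeSection 𝓕 S₀ :=
    { α :=
        -- The `ι` of `h x`, whose underlying object is only isomorphic to `x`, transported along `i
        -- x`.
        { app := fun x => 𝓕.Y.map (i x).inv ≫ (h.functor.obj x).ι ≫
            S₀.functor.map (𝓡.F.map (i x).hom)
          naturality := fun x y f => by
            simp only [Functor.comp_map, Category.assoc]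
            rw [← S₀.functor.map_comp, ← 𝓡.F.map_comp, ← hi, 𝓡.F.map_comp, S₀.functor.map_comp,
              ← Category.assoc (h.functor.obj x).ι, ← (h.functor.map f).comm, ← Category.assoc,
              ← 𝓕.Y.map_comp, hi', 𝓕.Y.map_comp]
            simp only [Category.assoc] }
      isOver := fun x => by
        have n₁ := S₀.iso.hom.naturality (𝓡.F.map (i x).hom)
        have n₂ := 𝓕.fac.hom.naturality (i x).hom
        simp only [Functor.comp_map, Functor.id_map] at n₁ n₂
        simp only [Functor.map_comp, Category.assoc]
        erw [n₁]
        rw [← Category.assoc (𝓕.G.map (h.functor.obj x).ι), (h.functor.obj x).isOver, ← n₂,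
          ← Category.assoc, ← 𝓕.G.map_comp, ← 𝓕.Y.map_comp, (i x).inv_hom_id]
        simp }
  refine ⟨s, fun x a => ?_⟩
  have comm : 𝓕.Y.map (i x).inv ≫ (h.functor.obj x).ι =
      (𝓕.Y.map (i x).inv ≫ (h.functor.obj x).ι ≫ S₀.functor.map (𝓡.F.map (i x).hom)) ≫
        S₀.functor.map (𝓡.F.map (i x).inv) := by
    simp only [Category.assoc]
    rw [← S₀.functor.map_comp, ← 𝓡.F.map_comp, (i x).hom_inv_id]
    simp
  -- By construction of `α`, the renaming `(i x)⁻¹` lifts to the inserter. Restriction along it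
  -- takes the good variable `h a` back to `a`, and preserves goodness.
  let j : s.toInserter.obj x ⟶ h.functor.obj x := ⟨(i x).inv, comm⟩
  have ha : (act h.onVar a).1 = res 𝓡.Var (i x).hom a := hθ.onVar a
  have hja : res 𝓡.Var (i x).inv (act h.onVar a).1 = a := by
    rw [ha, ← res_comp, (i x).inv_hom_id, res_id]
  exact (congrArg (Inserter.IsGood var' (s.toInserter.obj x)) hja).mp ((act h.onVar a).2.res var' j)

/-! ### The glueing category -/

/-- An object of the glueing of `S` along the nerve of `F : C ⥤ S`: an object `ctx` of `S` with a
presheaf over `C` and a map from it to `c ↦ (F c ⟶ ctx)`. -/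
structure Glueing {C : Type u} [Category.{u} C] {S : Type u} [Category.{u} S] (F : C ⥤ S) where
  ctx : S
  psh : Cᵒᵖ ⥤ Type u
  π : ∀ {c : C}, psh.obj (op c) → (F.obj c ⟶ ctx)
  π_res : ∀ {c d : C} (σ : d ⟶ c) (z : psh.obj (op c)), π (res psh σ z) = F.map σ ≫ π z

namespace Glueing

variable {C : Type u} [Category.{u} C] {S : Type u} [Category.{u} S] {F : C ⥤ S}

/-- Morphisms of the glueing category. -/
structure Hom (Z Z' : Glueing F) where
  fst : Z.ctx ⟶ Z'.ctx
  snd : Z.psh ⟶ Z'.psh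
  isOver : ∀ {c : C} (z : Z.psh.obj (op c)), Z'.π (ap snd z) = Z.π z ≫ fst

theorem psh_hom_ext {X X' : Cᵒᵖ ⥤ Type u} {f g : X ⟶ X'}
    (h : ∀ (c : C) (x : X.obj (op c)), ap f x = ap g x) : f = g := by
  ext c x
  exact h c.unop x

theorem Hom.ext_ap {Z Z' : Glueing F} {θ θ' : Hom Z Z'} (h₁ : θ.fst = θ'.fst)
    (h₂ : ∀ (c : C) (z : Z.psh.obj (op c)), ap θ.snd z = ap θ'.snd z) : θ = θ' := by
  obtain ⟨f, s, _⟩ := θ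
  obtain ⟨f', s', _⟩ := θ'
  obtain rfl : f = f' := h₁
  obtain rfl : s = s' := psh_hom_ext h₂
  rfl

instance : Category (Glueing F) where
  Hom := Hom
  id Z := ⟨𝟙 Z.ctx, 𝟙 Z.psh, fun z => (Category.comp_id _).symm⟩
  comp θ θ' := ⟨θ.fst ≫ θ'.fst, θ.snd ≫ θ'.snd, fun z =>
    (θ'.isOver (ap θ.snd z)).trans (by rw [θ.isOver, Category.assoc])⟩
  id_comp θ := Hom.ext_ap (Category.id_comp _) fun _ _ => rfl
  comp_id θ := Hom.ext_ap (Category.comp_id _) fun _ _ => rfl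
  assoc _ _ _ := Hom.ext_ap (Category.assoc _ _ _) fun _ _ => rfl

variable (F) in
/-- The projection of the glueing category. -/
def proj : Glueing F ⥤ S where
  obj Z := Z.ctx
  map θ := θ.fst

/-- The morphism of `S` given by an element of the presheaf of an object. -/
def pi {Z : Glueing F} {c : C} (z : Z.psh.obj (op c)) : F.obj c ⟶ (proj F).obj Z :=
  Z.π z

theorem pi_res {Z : Glueing F} {c d : C} (σ : d ⟶ c) (z : Z.psh.obj (op c)) :
    pi (res Z.psh σ z) = F.map σ ≫ pi z :=
  Z.π_res σ z

/-- The action of a morphism on the elements of the presheaves. -/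
def push {Z Z' : Glueing F} (θ : Z ⟶ Z') {c : C} (z : Z.psh.obj (op c)) : Z'.psh.obj (op c) :=
  ap θ.snd z

theorem push_res {Z Z' : Glueing F} (θ : Z ⟶ Z') {c d : C} (σ : d ⟶ c) (z : Z.psh.obj (op c)) :
    push θ (res Z.psh σ z) = res Z'.psh σ (push θ z) :=
  ap_res θ.snd σ z

theorem pi_push {Z Z' : Glueing F} (θ : Z ⟶ Z') {c : C} (z : Z.psh.obj (op c)) :
    pi (push θ z) = pi z ≫ (proj F).map θ :=
  θ.isOver z

theorem hom_ext {Z Z' : Glueing F} {θ θ' : Z ⟶ Z'} (h₁ : (proj F).map θ = (proj F).map θ')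
    (h₂ : ∀ (c : C) (z : Z.psh.obj (op c)), push θ z = push θ' z) : θ = θ' :=
  Hom.ext_ap h₁ h₂

/-! ### Yoneda for the glueing category. -/

/-- The map from a representable presheaf given by an element. -/
def ofElt (X : Cᵒᵖ ⥤ Type u) {c : C} (x : X.obj (op c)) : yoneda.obj c ⟶ X where
  app d := TypeCat.ofHom fun (σ : d.unop ⟶ c) => res X σ x
  naturality d d' τ := by
    ext σ
    exact res_comp X τ.unop σ x

variable (F) in
/-- The embedding of `C` into the glueing category. -/
def Y : C ⥤ Glueing F where
  obj c := ⟨F.obj c, yoneda.obj c, fun σ => F.map σ, fun σ τ => F.map_comp σ τ⟩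
  map σ := ⟨F.map σ, yoneda.map σ, fun τ => F.map_comp τ σ⟩
  map_id c := hom_ext (F.map_id c) fun _ σ => Category.comp_id (Y := c) σ
  map_comp {c _ _} σ τ := hom_ext (F.map_comp σ τ) fun _ ρ =>
    (Category.assoc (X := c) ρ σ τ).symm

/-- An element of a representable object. -/
def yo {c d : C} (σ : d ⟶ c) : ((Y F).obj c).psh.obj (op d) :=
  σ

theorem res_yo {c d e : C} (τ : e ⟶ d) (σ : d ⟶ c) :
    res ((Y F).obj c).psh τ (yo σ) = yo (τ ≫ σ) :=
  rfl

theorem push_Y_map {c d e : C} (σ : d ⟶ c) (τ : e ⟶ d) :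
    push ((Y F).map σ) (yo τ) = yo (τ ≫ σ) :=
  rfl

theorem push_yo {Z : Glueing F} {c d : C} (θ : (Y F).obj c ⟶ Z) (σ : d ⟶ c) :
    push θ (yo σ) = res Z.psh σ (push θ (yo (𝟙 c))) := by
  rw [← push_res, res_yo, Category.comp_id]

/-- The morphism from a representable object given by an element. -/
def point {Z : Glueing F} {c : C} (z : Z.psh.obj (op c)) : (Y F).obj c ⟶ Z :=
  ⟨Z.π z, ofElt Z.psh z, fun σ => Z.π_res σ z⟩

theorem push_point {Z : Glueing F} {c d : C} (z : Z.psh.obj (op c)) (σ : d ⟶ c) :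
    push (point z) (yo σ) = res Z.psh σ z :=
  rfl

theorem Y_map_point {Z : Glueing F} {c d : C} (σ : d ⟶ c) (z : Z.psh.obj (op c)) :
    (Y F).map σ ≫ point z = point (res Z.psh σ z) :=
  hom_ext (Z.π_res σ z).symm fun _ τ => res_comp Z.psh τ σ z

theorem point_comp {Z Z' : Glueing F} (θ : Z ⟶ Z') {c : C} (z : Z.psh.obj (op c)) :
    point z ≫ θ = point (push θ z) :=
  hom_ext (pi_push θ z).symm fun _ σ => push_res θ σ z

theorem point_yo {c d : C} (σ : d ⟶ c) : point (yo (F := F) σ) = (Y F).map σ :=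
  hom_ext rfl fun _ _ => rfl

/-- By Yoneda the presheaf component is given by an element at the identity, and the image of that
element under `π` forces the component in `S`. -/
instance : (Y F).Full where
  map_surjective {c d} θ := by
    have h : θ = (Y F).map (push θ (yo (𝟙 c))) := by
      refine hom_ext ?_ fun e σ => ?_
      · have h₁ : F.map (𝟙 c) ≫ (proj F).map θ = (proj F).map θ :=
          (congrArg (fun k : F.obj c ⟶ F.obj c => k ≫ (proj F).map θ) (F.map_id c)).trans
            (Category.id_comp (X := F.obj c) _)
        exact h₁.symm.trans (pi_push θ (yo (𝟙 c))).symm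
      · exact push_yo θ σ
    exact ⟨_, h.symm⟩

instance : (Y F).Faithful where
  map_injective {c d f g} h := by
    have : push ((Y F).map f) (yo (𝟙 c)) = push ((Y F).map g) (yo (𝟙 c)) := by rw [h]
    rw [push_Y_map, push_Y_map, Category.id_comp, Category.id_comp] at this
    exact this

/-! ### Glued presheaves -/

section Glued

variable {X : Cᵒᵖ ⥤ Type u} {X' : Sᵒᵖ ⥤ Type u} {b : X ⟶ F.op ⋙ X'}

/-- The elements of a glued presheaf over `Z`: an element over `Z.ctx` with a displayed element
over it for all elements of `Z.psh`. -/
structure Elt (b : X ⟶ F.op ⋙ X') (Z : Glueing F) where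
  fst : X'.obj (op Z.ctx)
  snd : Z.psh ⟶ X
  isOver : ∀ {c : C} (z : Z.psh.obj (op c)), act b (ap snd z) = res X' (Z.π z) fst

theorem Elt.ext_ap {Z : Glueing F} {e e' : Elt b Z} (h₁ : e.fst = e'.fst)
    (h₂ : ∀ (c : C) (z : Z.psh.obj (op c)), ap e.snd z = ap e'.snd z) : e = e' := by
  obtain ⟨f, s, _⟩ := e
  obtain ⟨f', s', _⟩ := e'
  obtain rfl : f = f' := h₁
  obtain rfl : s = s' := psh_hom_ext h₂
  rfl

variable (b) in
/-- The presheaf over the glueing category that is glued from a map `X ⟶ F^* X'`. -/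
def glued : (Glueing F)ᵒᵖ ⥤ Type u where
  obj Z := Elt b Z.unop
  map θ := TypeCat.ofHom fun e => ⟨res X' θ.unop.fst e.fst, θ.unop.snd ≫ e.snd, fun z =>
    (e.isOver (ap θ.unop.snd z)).trans (by rw [θ.unop.isOver, res_comp])⟩
  map_id Z := by
    ext e
    exact Elt.ext_ap (res_id X' e.fst) fun _ _ => rfl
  map_comp θ θ' := by
    ext e
    exact Elt.ext_ap (res_comp X' _ _ e.fst) fun _ _ => rfl

variable (b) in
/-- The first projection of a glued presheaf. -/
def gluedFst : glued b ⟶ (proj F).op ⋙ X' where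
  app _ := TypeCat.ofHom fun e => e.fst

/-- The value of an element of a glued presheaf. -/
def val {Z : Glueing F} (e : (glued b).obj (op Z)) {c : C} (z : Z.psh.obj (op c)) : X.obj (op c) :=
  ap (Elt.snd e) z

theorem act_val {Z : Glueing F} (e : (glued b).obj (op Z)) {c : C} (z : Z.psh.obj (op c)) :
    act b (val e z) = res X' (pi z) (act (gluedFst b) e) :=
  Elt.isOver e z

theorem res_val {Z : Glueing F} (e : (glued b).obj (op Z)) {c d : C} (σ : d ⟶ c)
    (z : Z.psh.obj (op c)) : val e (res Z.psh σ z) = res X σ (val e z) :=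
  ap_res (Elt.snd e) σ z

theorem glued_ext {Z : Glueing F} {e e' : (glued b).obj (op Z)}
    (h₁ : act (gluedFst b) e = act (gluedFst b) e')
    (h₂ : ∀ (c : C) (z : Z.psh.obj (op c)), val e z = val e' z) : e = e' :=
  Elt.ext_ap h₁ h₂

theorem val_res {Z Z' : Glueing F} (θ : Z' ⟶ Z) (e : (glued b).obj (op Z)) {c : C}
    (z : Z'.psh.obj (op c)) : val (res (glued b) θ e) z = val e (push θ z) :=
  rfl

variable (b) in
/-- Construction of an element of a glued presheaf. -/
def gluedMk {Z : Glueing F} (fst : X'.obj (op ((proj F).obj Z)))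
    (snd : ∀ {c : C}, Z.psh.obj (op c) → X.obj (op c))
    (hres : ∀ {c d : C} (σ : d ⟶ c) (z : Z.psh.obj (op c)),
      snd (res Z.psh σ z) = res X σ (snd z))
    (hact : ∀ {c : C} (z : Z.psh.obj (op c)), act b (snd z) = res X' (pi z) fst) :
    (glued b).obj (op Z) :=
  ⟨fst, { app := fun _ => TypeCat.ofHom fun z => snd z,
          naturality := fun _ _ σ => by
            ext z
            exact hres σ.unop z }, hact⟩

variable (b) in
/-- The element of a glued presheaf over a representable object given by an element of `X`. -/
def mkElt {c : C} (x : X.obj (op c)) : (glued b).obj (op ((Y F).obj c)) :=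
  ⟨act b x, ofElt X x, fun σ => act_res b σ x⟩

theorem val_mkElt {c d : C} (x : X.obj (op c)) (σ : d ⟶ c) :
    val (mkElt b x) (yo σ) = res X σ x :=
  rfl

theorem res_mkElt {c d : C} (σ : d ⟶ c) (x : X.obj (op c)) :
    res (glued b) ((Y F).map σ) (mkElt b x) = mkElt b (res X σ x) :=
  glued_ext (act_res b σ x).symm fun _ τ => res_comp X τ σ x

/-- Values at elements are restrictions along points, so the displayed part of an element over any
`Z` is visible on representables. -/
theorem res_point {Z : Glueing F} (e : (glued b).obj (op Z)) {c : C} (z : Z.psh.obj (op c)) :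
    res (glued b) (point z) e = mkElt b (val e z) :=
  glued_ext (act_val e z).symm fun _ τ => res_val e τ z

theorem val_yo {c d : C} (e : (glued b).obj (op ((Y F).obj c))) (σ : d ⟶ c) :
    val e (yo σ) = res X σ (val e (yo (𝟙 c))) := by
  rw [← res_val, res_yo, Category.comp_id]

theorem fst_eq_act {c : C} (e : (glued b).obj (op ((Y F).obj c))) :
    act (gluedFst b) e = act b (val e (yo (𝟙 c))) := by
  rw [act_val]
  change _ = res X' (F.map (𝟙 c)) _
  rw [F.map_id]
  exact (res_id X' _).symm

/-- Yoneda again: the displayed part is determined by its value at the identity, and the base part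
is the base of this value (`fst_eq_act`). -/
theorem mkElt_bijective (c : C) : Function.Bijective fun x : X.obj (op c) => mkElt b x := by
  constructor
  · intro x x' h
    have : val (mkElt b x) (yo (𝟙 c)) = val (mkElt b x') (yo (𝟙 c)) :=
      congrArg (fun e : (glued b).obj (op ((Y F).obj c)) => val e (yo (𝟙 c))) h
    rwa [val_mkElt, val_mkElt, res_id, res_id] at this
  · intro e
    exact ⟨val e (yo (𝟙 c)), glued_ext (fst_eq_act e).symm fun d τ => (val_yo e τ).symm⟩

/-- The action of the embedding on a glued presheaf. -/
def mkEltHom (b : X ⟶ F.op ⋙ X') : X ⟶ (Y F).op ⋙ glued b where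
  app c := TypeCat.ofHom fun x => mkElt b (c := c.unop) x
  naturality c d σ := by
    ext x
    exact (res_mkElt σ.unop x).symm

end Glued

end Glueing

/-! ### Extensionality of the displayed operations -/

namespace DispModel

variable {C : Type o₁} [Category.{h₁} C] {S : Type o₂} [Category.{h₂} S] {F : C ⥤ S}
  {M : Model.{t} S} (D : DispModel F M) {Γ : C}

/-- The domains and the proof arguments may differ on the two sides; pointwise equality of the
families suffices. The versions for `lam` and `boolElim` are used likewise in every naturality check
below. -/
theorem Pi_congr {A₁ A₂ : M.Ty.obj (op (F.obj Γ))} {B₁ : Fam M.toTypeFamily A₁ M.Ty}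
    {B₂ : Fam M.toTypeFamily A₂ M.Ty} {A₁' A₂' : D.Ty.obj (op Γ)} {h₁ h₂}
    {B₁' : Fam D.toTypeFamily A₁' D.Ty} {B₂' : Fam D.toTypeFamily A₂' D.Ty} {hB₁ hB₂}
    (hA : A₁' = A₂')
    (hB : ∀ (Δ : S) (σ : Δ ⟶ F.obj Γ) (a) (h₁ h₂), B₁.val σ a h₁ = B₂.val σ a h₂)
    (hB' : ∀ (Δ : C) (σ : Δ ⟶ Γ) (a) (h₁ h₂), B₁'.val σ a h₁ = B₂'.val σ a h₂) :
    D.Pi B₁ A₁' h₁ B₁' hB₁ = D.Pi B₂ A₂' h₂ B₂' hB₂ := by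
  subst hA h₁ h₂
  obtain rfl : B₁ = B₂ := Fam.eq_of_val fun Δ σ a h => hB Δ σ a h h
  obtain rfl : B₁' = B₂' := Fam.eq_of_val fun Δ σ a h => hB' Δ σ a h h
  rfl

theorem lam_congr {A₁ A₂ : M.Ty.obj (op (F.obj Γ))} {b₁ : Fam M.toTypeFamily A₁ M.Tm}
    {b₂ : Fam M.toTypeFamily A₂ M.Tm} {A₁' A₂' : D.Ty.obj (op Γ)} {h₁ h₂}
    {b₁' : Fam D.toTypeFamily A₁' D.Tm} {b₂' : Fam D.toTypeFamily A₂' D.Tm} {hb₁ hb₂}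
    (hA : A₁' = A₂')
    (hb : ∀ (Δ : S) (σ : Δ ⟶ F.obj Γ) (a) (h₁ h₂), b₁.val σ a h₁ = b₂.val σ a h₂)
    (hb' : ∀ (Δ : C) (σ : Δ ⟶ Γ) (a) (h₁ h₂), b₁'.val σ a h₁ = b₂'.val σ a h₂) :
    D.lam b₁ A₁' h₁ b₁' hb₁ = D.lam b₂ A₂' h₂ b₂' hb₂ := by
  subst hA h₁ h₂
  obtain rfl : b₁ = b₂ := Fam.eq_of_val fun Δ σ a h => hb Δ σ a h h
  obtain rfl : b₁' = b₂' := Fam.eq_of_val fun Δ σ a h => hb' Δ σ a h h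
  rfl

theorem boolElim_congr {P₁ P₂ : Fam M.toTypeFamily (M.bool (F.obj Γ)) M.Ty}
    {P₁' P₂' : Fam D.toTypeFamily (D.bool Γ) D.Ty} {hP₁ hP₂} {t₁ t₂ f₁ f₂ b₁ b₂ : D.Tm.obj (op Γ)}
    {ht₁ ht₂ hf₁ hf₂ hb₁ hb₂}
    (hP : ∀ (Δ : S) (σ : Δ ⟶ F.obj Γ) (a) (h), P₁.val σ a h = P₂.val σ a h)
    (hP' : ∀ (Δ : C) (σ : Δ ⟶ Γ) (a) (h), P₁'.val σ a h = P₂'.val σ a h)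
    (ht : t₁ = t₂) (hf : f₁ = f₂) (hb : b₁ = b₂) :
    D.boolElim P₁ P₁' hP₁ t₁ f₁ b₁ ht₁ hf₁ hb₁ = D.boolElim P₂ P₂' hP₂ t₂ f₂ b₂ ht₂ hf₂ hb₂ := by
  obtain rfl : P₁ = P₂ := Fam.eq_of_val hP
  obtain rfl : P₁' = P₂' := Fam.eq_of_val hP'
  subst ht hf hb
  rfl

end DispModel

namespace Glueing

/-! ### Families over the glueing category -/

variable {C : Type u} [Category.{u} C] {S : Type u} [Category.{u} S] {F : C ⥤ S}
  {M : Model.{u} S} {D : DispModel F M}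

variable (D) in
/-- The types of the terms of the glued type family. -/
def gluedTp : glued D.base.tm ⟶ glued D.base.ty where
  app Z := TypeCat.ofHom fun e => ⟨ap M.tp (Elt.fst e), Elt.snd e ≫ D.tp, fun z =>
    (D.base.tp_tm (ap (Elt.snd e) z)).symm.trans
      ((congrArg (ap M.tp) (Elt.isOver e z)).trans (ap_res _ _ _))⟩
  naturality Z Z' θ := by
    ext e
    exact Elt.ext_ap (ap_res M.tp _ _) fun _ _ => rfl

variable (D) in
/-- The glued type family. -/
abbrev gluedFamily : TypeFamily.{u} (Glueing F) where
  Ty := glued D.base.ty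
  Tm := glued D.base.tm
  tp := gluedTp D

theorem fst_tp {Z : Glueing F} (e : (glued D.base.tm).obj (op Z)) :
    act (gluedFst D.base.ty) (ap (gluedTp D) e) = ap M.tp (act (gluedFst D.base.tm) e) :=
  rfl

theorem val_tp {Z : Glueing F} (e : (glued D.base.tm).obj (op Z)) {c : C} (z : Z.psh.obj (op c)) :
    val (ap (gluedTp D) e) z = ap D.tp (val e z) :=
  rfl

theorem tp_mkElt {c : C} (a : D.Tm.obj (op c)) :
    ap (gluedTp D) (mkElt D.base.tm a) = mkElt D.base.ty (ap D.tp a) :=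
  glued_ext (D.base.tp_tm a) fun _ σ => ap_res D.tp σ a

variable (D) in
/-- The projection of the glued type family. -/
abbrev gluedBase : FamilyMap (proj F) (gluedFamily D) M.toTypeFamily where
  ty := gluedFst D.base.ty
  tm := gluedFst D.base.tm
  tp_tm _ := rfl

variable {X : Cᵒᵖ ⥤ Type u} {X' : Sᵒᵖ ⥤ Type u} {b : X ⟶ F.op ⋙ X'} {Z : Glueing F}
  {A' : (glued D.base.ty).obj (op Z)} {A : M.Ty.obj (op ((proj F).obj Z))}

theorem tp_mkElt_eq {c d : C} {z : Z.psh.obj (op c)} {A₀ : D.Ty.obj (op c)} (e : val A' z = A₀)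
    {σ : d ⟶ c} {a : D.Tm.obj (op d)} (h : ap D.tp a = res D.Ty σ A₀) :
    ap (gluedTp D) (mkElt D.base.tm a) =
      res (glued D.base.ty) (point (res Z.psh σ z)) A' := by
  rw [tp_mkElt, h, res_point, res_val, e]

theorem tp_val {Z' : Glueing F} {θ : Z' ⟶ Z} {a : (glued D.base.tm).obj (op Z')}
    (h : ap (gluedTp D) a = res (glued D.base.ty) θ A') {c : C} (z : Z'.psh.obj (op c)) :
    ap D.tp (val a z) = val A' (push θ z) := by
  rw [← val_tp, h, val_res]

/-- The fiber over an element of `Z.psh` of a family over `Z`. -/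
def fiber (B : Fam (gluedFamily D) A' (glued b)) {c : C} (z : Z.psh.obj (op c))
    {A₀ : D.Ty.obj (op c)} (e : val A' z = A₀) : Fam D.toTypeFamily A₀ X where
  -- The family is evaluated over the representable object that classifies `z[σ]` and read off at
  -- the identity. `A₀` is kept separate from `val A' z` so that fibres can be typed over a known
  -- form such as `D.bool c`.
  val {d} σ a h := val (B.val (point (res Z.psh σ z)) (mkElt D.base.tm a) (tp_mkElt_eq e h))
    (yo (𝟙 d))
  val_res {d d'} τ σ a h := by
    have h₁ := B.val_res ((Y F).map τ) _ _ (tp_mkElt_eq e h)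
    rw [← val_yo, ← Category.id_comp τ, ← push_Y_map, ← val_res, h₁, Category.id_comp]
    congr 1
    refine B.val_congr _ ?_ (res_mkElt τ a)
    rw [Y_map_point, res_comp]

/-- Naturality along `point z` recovers all displayed values of a family from its fibres; this
underlies `fam_ext`. -/
theorem val_eq_fiber (B : Fam (gluedFamily D) A' (glued b)) {Z' : Glueing F} (θ : Z' ⟶ Z)
    (a : (glued D.base.tm).obj (op Z')) (h : ap (gluedTp D) a = res (glued D.base.ty) θ A') {c : C}
    (z : Z'.psh.obj (op c)) {A₀ : D.Ty.obj (op c)} (e : val A' (push θ z) = A₀) (h') :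
    val (B.val θ a h) z = (fiber B (push θ z) e).at' (val a z) h' := by
  have h₁ := B.val_res (point z) θ a h
  have h₂ : val (B.val θ a h) z = val (res (glued b) (point z) (B.val θ a h)) (yo (𝟙 c)) := by
    rw [val_res, push_point, res_id]
  rw [h₂, h₁]
  change _ = val (B.val _ _ _) _
  congr 1
  refine B.val_congr _ ?_ (res_point a z)
  rw [point_comp, res_id]

theorem val_at' (B : Fam (gluedFamily D) A' (glued b)) (a : (glued D.base.tm).obj (op Z))
    (h : ap (gluedTp D) a = A') {c : C} (z : Z.psh.obj (op c)) {A₀ : D.Ty.obj (op c)}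
    (e : val A' z = A₀) (h') : val (B.at' a h) z = (fiber B z e).at' (val a z) h' :=
  val_eq_fiber B (𝟙 Z) a _ z e h'

/-- For `τ` the identity this is the compatibility that `glueFam` asks of prescribed fibres; in
general it gives naturality in `z` of the fibrewise operations. -/
theorem fiber_res (B : Fam (gluedFamily D) A' (glued b)) {c d d' : C} (σ : d ⟶ c)
    (z : Z.psh.obj (op c)) {A₀ : D.Ty.obj (op c)} {A₁ : D.Ty.obj (op d)} (e : val A' z = A₀)
    (e' : val A' (res Z.psh σ z) = A₁) (τ : d' ⟶ d) (a : D.Tm.obj (op d')) (h h') :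
    (fiber B (res Z.psh σ z) e').val τ a h = (fiber B z e).val (τ ≫ σ) a h' := by
  change val (B.val _ _ _) _ = val (B.val _ _ _) _
  congr 1
  refine B.val_congr _ ?_ rfl
  rw [res_comp]

/-- Fibers of restrictions. -/
theorem fiber_restrict (B : Fam (gluedFamily D) A' (glued b)) {Z' : Glueing F} (θ : Z' ⟶ Z)
    {A'' : (glued D.base.ty).obj (op Z')} (e : res (glued D.base.ty) θ A' = A'') {c d : C}
    (z : Z'.psh.obj (op c)) {A₀ A₁ : D.Ty.obj (op c)} (h₀ : val A'' z = A₀)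
    (h₁ : val A' (push θ z) = A₁) (τ : d ⟶ c) (a : D.Tm.obj (op d)) (h h') :
    (fiber (B.restrict θ e) z h₀).val τ a h = (fiber B (push θ z) h₁).val τ a h' := by
  change val (B.val _ _ _) _ = val (B.val _ _ _) _
  congr 1
  refine B.val_congr _ ?_ rfl
  rw [point_comp, push_res]

theorem act_fiber_ty (hA : act (gluedFst D.base.ty) A' = A) {c : C} (z : Z.psh.obj (op c))
    {A₀ : D.Ty.obj (op c)} (e : val A' z = A₀) : act D.base.ty A₀ = res M.Ty (pi z) A := by
  rw [← e, act_val, hA]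

theorem matches_fiber {hA : act (gluedFst D.base.ty) A' = A}
    {B' : Fam (gluedFamily D) A' (glued b)} {B : Fam M.toTypeFamily A X'}
    (hB : (gluedBase D).Matches hA (gluedFst b) B' B) {c : C} (z : Z.psh.obj (op c))
    {A₀ : D.Ty.obj (op c)} (e : val A' z = A₀) {A₁ : M.Ty.obj (op (F.obj c))}
    (e₁ : res M.Ty (pi z) A = A₁) (h : act D.base.ty A₀ = A₁) :
    D.base.Matches h b (fiber B' z e) (B.restrict (pi z) e₁) := by
  intro d σ a h'
  have h₁ := hB (point (res Z.psh σ z)) (mkElt D.base.tm a) (tp_mkElt_eq e h')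
  exact (B.val_congr _ (pi_res σ z).symm rfl).trans (h₁.trans (fst_eq_act _))

/-- A family over a glueing object is determined by the family over which it lies and by its
fibers. -/
theorem fam_ext {hA : act (gluedFst D.base.ty) A' = A} {B₁ B₂ : Fam (gluedFamily D) A' (glued b)}
    {B : Fam M.toTypeFamily A X'} (h₁ : (gluedBase D).Matches hA (gluedFst b) B₁ B)
    (h₂ : (gluedBase D).Matches hA (gluedFst b) B₂ B)
    (H : ∀ (c : C) (z : Z.psh.obj (op c)), fiber B₁ z rfl = fiber B₂ z rfl) : B₁ = B₂ := by
  refine Fam.eq_of_val fun Z' θ a h => glued_ext ?_ fun c z => ?_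
  · rw [← h₁ θ a h, ← h₂ θ a h]
  · rw [val_eq_fiber B₁ θ a h z rfl (tp_val h z), val_eq_fiber B₂ θ a h z rfl (tp_val h z), H]

/-- The family over a glueing object with given fibers over a given family. -/
def glueFam (hA : act (gluedFst D.base.ty) A' = A) (B : Fam M.toTypeFamily A X')
    (β : ∀ {c : C} (z : Z.psh.obj (op c)), Fam D.toTypeFamily (val A' z) X)
    (hβ : ∀ {c d : C} (σ : d ⟶ c) (z : Z.psh.obj (op c)) (a : D.Tm.obj (op d)) (h h'),
      (β (res Z.psh σ z)).at' a h = (β z).val σ a h')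
    (hβB : ∀ {c : C} (z : Z.psh.obj (op c)),
      D.base.Matches (act_fiber_ty hA z rfl) b (β z) (B.restrict (pi z) rfl)) :
    Fam (gluedFamily D) A' (glued b) where
  val {Z'} θ a h := gluedMk b (B.val ((proj F).map θ) (act (gluedFst D.base.tm) a)
      ((gluedBase D).tp_tm_eq hA h)) (fun {c} z => (β (push θ z)).at' (val a z) (tp_val h z))
    (fun σ z => by
      -- The element and the term are generalized together with the typing proof, so that both can
      -- be substituted at once.
      have key : ∀ (z' : Z.psh.obj _) (a' : D.Tm.obj _) (h'), z' = res Z.psh σ (push θ z) →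
          a' = res D.Tm σ (val a z) →
          (β z').at' a' h' = res X σ ((β (push θ z)).at' (val a z) (tp_val h z)) := by
        rintro _ _ h' rfl rfl
        rw [Fam.res_at']
        exact hβ _ _ _ _ _
      exact key _ _ _ (push_res θ σ z) (res_val a σ z))
    (fun {c} z => by
      have h₁ := hβB (push θ z) (𝟙 c) (val a z) (D.toTypeFamily.tp_id (tp_val h z))
      refine h₁.symm.trans ?_
      rw [B.val_res]
      refine B.val_congr _ ?_ (act_val a z)
      rw [F.map_id, Category.id_comp, pi_push])
  val_res {Z₁ Z₂} τ θ a h := by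
    refine glued_ext ?_ fun c z => rfl
    rw [act_res]
    refine (B.val_res _ _ _ _).trans ?_
    exact B.val_congr _ ((proj F).map_comp τ θ).symm rfl

section GlueFam

variable {hA : act (gluedFst D.base.ty) A' = A} {B : Fam M.toTypeFamily A X'}
  {β : ∀ {c : C} (z : Z.psh.obj (op c)), Fam D.toTypeFamily (val A' z) X}
  {hβ : ∀ {c d : C} (σ : d ⟶ c) (z : Z.psh.obj (op c)) (a : D.Tm.obj (op d)) (h h'),
    (β (res Z.psh σ z)).at' a h = (β z).val σ a h'}
  {hβB : ∀ {c : C} (z : Z.psh.obj (op c)),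
    D.base.Matches (act_fiber_ty hA z rfl) b (β z) (B.restrict (pi z) rfl)}

theorem matches_glueFam :
    (gluedBase D).Matches hA (gluedFst b) (glueFam hA B β hβ hβB) B :=
  fun _ _ _ _ => rfl

theorem fiber_glueFam {c : C} (z : Z.psh.obj (op c)) :
    fiber (glueFam hA B β hβ hβB) z rfl = β z := by
  refine Fam.eq_of_val fun d σ a h => ?_
  have key : ∀ (z' : Z.psh.obj (op d)) (a' : D.Tm.obj (op d)) (h'), z' = res Z.psh σ z →
      a' = a → (β z').at' a' h' = (β z).val σ a h := by
    rintro _ _ h' rfl rfl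
    exact hβ _ _ _ _ _
  exact key _ _ (tp_val (tp_mkElt_eq rfl h) _) (res_id Z.psh _) (res_id D.Tm a)

end GlueFam

end Glueing

namespace Glueing

/-! ### The glued displayed model -/

variable {C : Type u} [Category.{u} C] {S : Type u} [Category.{u} S] {F : C ⥤ S}
  {M : Model.{u} S} {D : DispModel F M} {Z : Glueing F}

/-! ### Π-types and abstractions, computed fibrewise. -/

section Pi

variable {A : M.Ty.obj (op ((proj F).obj Z))} {A' : (glued D.base.ty).obj (op Z)}

/-- The Π-types of the glued displayed model. -/
def gluedPi (B : Fam M.toTypeFamily A M.Ty) (A' : (glued D.base.ty).obj (op Z))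
    (hA : act (gluedFst D.base.ty) A' = A) (B' : Fam (gluedFamily D) A' (glued D.base.ty))
    (hB : (gluedBase D).Matches hA (gluedFst D.base.ty) B' B) : (glued D.base.ty).obj (op Z) :=
  gluedMk D.base.ty (M.Pi A B)
    (fun z => D.Pi (B.restrict (pi z) rfl) (val A' z) (act_fiber_ty hA z rfl) (fiber B' z rfl)
      (matches_fiber hB z rfl rfl _))
    (fun σ z => by
      rw [D.Pi_res σ _ _ _ _ _ (by rw [act_res, act_fiber_ty hA z rfl])]
      refine D.Pi_congr (res_val A' σ z) (fun Δ τ a h₁ h₂ => ?_) fun Δ τ a h₁ h₂ => ?_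
      · refine B.val_congr _ ?_ rfl
        rw [pi_res, Category.assoc]
      · exact fiber_res B' σ z rfl rfl τ a h₁ (by rw [res_comp, ← h₂]))
    (fun z => by rw [D.base_Pi, M.Pi_res])

theorem val_gluedPi (B : Fam M.toTypeFamily A M.Ty) (A' : (glued D.base.ty).obj (op Z))
    (hA : act (gluedFst D.base.ty) A' = A) (B' : Fam (gluedFamily D) A' (glued D.base.ty))
    (hB : (gluedBase D).Matches hA (gluedFst D.base.ty) B' B) {c : C} (z : Z.psh.obj (op c)) :
    val (gluedPi B A' hA B' hB) z = D.Pi (B.restrict (pi z) rfl) (val A' z)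
      (act_fiber_ty hA z rfl) (fiber B' z rfl) (matches_fiber hB z rfl rfl _) :=
  rfl

/-- The abstractions of the glued displayed model. -/
def gluedLam (b : Fam M.toTypeFamily A M.Tm) (A' : (glued D.base.ty).obj (op Z))
    (hA : act (gluedFst D.base.ty) A' = A) (b' : Fam (gluedFamily D) A' (glued D.base.tm))
    (hb : (gluedBase D).Matches hA (gluedFst D.base.tm) b' b) : (glued D.base.tm).obj (op Z) :=
  gluedMk D.base.tm (M.lam A b)
    (fun z => D.lam (b.restrict (pi z) rfl) (val A' z) (act_fiber_ty hA z rfl) (fiber b' z rfl)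
      (matches_fiber hb z rfl rfl _))
    (fun σ z => by
      rw [D.lam_res σ _ _ _ _ _ (by rw [act_res, act_fiber_ty hA z rfl])]
      refine D.lam_congr (res_val A' σ z) (fun Δ τ a h₁ h₂ => ?_) fun Δ τ a h₁ h₂ => ?_
      · refine b.val_congr _ ?_ rfl
        rw [pi_res, Category.assoc]
      · exact fiber_res b' σ z rfl rfl τ a h₁ (by rw [res_comp, ← h₂]))
    (fun z => by rw [D.base_lam, M.lam_res])

theorem val_gluedLam (b : Fam M.toTypeFamily A M.Tm) (A' : (glued D.base.ty).obj (op Z))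
    (hA : act (gluedFst D.base.ty) A' = A) (b' : Fam (gluedFamily D) A' (glued D.base.tm))
    (hb : (gluedBase D).Matches hA (gluedFst D.base.tm) b' b) {c : C} (z : Z.psh.obj (op c)) :
    val (gluedLam b A' hA b' hb) z = D.lam (b.restrict (pi z) rfl) (val A' z)
      (act_fiber_ty hA z rfl) (fiber b' z rfl) (matches_fiber hb z rfl rfl _) :=
  rfl

theorem fiber_map_tp (b : Fam (gluedFamily D) A' (glued D.base.tm)) {c : C}
    (z : Z.psh.obj (op c)) {A₀ : D.Ty.obj (op c)} (e : val A' z = A₀) :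
    fiber (b.map (gluedTp D)) z e = (fiber b z e).map D.tp :=
  rfl

/-- In each fibre the displayed bijection of `D` gives a unique preimage. Uniqueness makes these
preimages compatible under restriction, so they glue over `b`, and it also gives uniqueness of the
glued family. -/
theorem gluedLam_bijective (B : Fam M.toTypeFamily A M.Ty) (A' : (glued D.base.ty).obj (op Z))
    (hA : act (gluedFst D.base.ty) A' = A) (B' : Fam (gluedFamily D) A' (glued D.base.ty))
    (hB : (gluedBase D).Matches hA (gluedFst D.base.ty) B' B) (b : Fam M.toTypeFamily A M.Tm)
    (hbB : b.map M.tp = B) (f' : (glued D.base.tm).obj (op Z))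
    (hf' : ap (gluedTp D) f' = gluedPi B A' hA B' hB)
    (hf : act (gluedFst D.base.tm) f' = M.lam A b) :
    ∃! b' : Fam (gluedFamily D) A' (glued D.base.tm), b'.map (gluedTp D) = B' ∧
      ∃ hb : (gluedBase D).Matches hA (gluedFst D.base.tm) b' b, gluedLam b A' hA b' hb = f' := by
  subst hbB
  have H {c : C} (z : Z.psh.obj (op c)) := D.lam_bijective _ (val A' z) (act_fiber_ty hA z rfl)
    (fiber B' z rfl) (matches_fiber hB z rfl rfl _) (b.restrict (pi z) rfl) rfl (val f' z)
    (by rw [← val_tp, hf', val_gluedPi]) (by rw [act_val, hf, M.lam_res])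
  choose β hβ hβu using @H
  have hβm {c : C} (z : Z.psh.obj (op c)) := (hβ z).2.choose
  have hβl {c : C} (z : Z.psh.obj (op c)) := (hβ z).2.choose_spec
  -- The restricted preimage solves the problem posed at `z[σ]`, so it is the chosen one.
  have hres {c d : C} (σ : d ⟶ c) (z : Z.psh.obj (op c)) :
      (β z).restrict σ (res_val A' σ z).symm = β (res Z.psh σ z) := by
    apply hβu
    refine ⟨?_, ?_, ?_⟩
    · refine Fam.eq_of_val fun Δ τ a h => ?_
      have := congrArg (fun k : Fam D.toTypeFamily (val A' z) D.Ty => k.val (τ ≫ σ) a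
        (by rw [h, res_val, res_comp])) (hβ z).1
      exact this.trans (fiber_res B' σ z rfl rfl τ a _ _).symm
    · have h₁ := (hβm z).restrict σ (res_val A' σ z).symm
        (A₁' := res M.Ty (pi (res Z.psh σ z)) A) (by rw [pi_res, res_comp])
        (act_fiber_ty hA _ rfl)
      rw [Fam.restrict_restrict] at h₁
      convert h₁ using 2
      exact pi_res σ z
    · refine Eq.trans ?_ ((congrArg (res D.Tm σ) (hβl z)).trans (res_val f' σ z).symm)
      rw [D.lam_res σ _ _ _ _ _ (by rw [act_res, act_fiber_ty hA z rfl])]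
      refine D.lam_congr (res_val A' σ z) (fun Δ τ a h₁ h₂ => ?_) fun Δ τ a h₁ h₂ => rfl
      refine b.val_congr _ ?_ rfl
      rw [pi_res, Category.assoc]
  let b' : Fam (gluedFamily D) A' (glued D.base.tm) := glueFam hA b (fun z => β z)
    (fun σ z a h h' => by
      rw [← hres, Fam.at'_restrict]) (fun z => hβm z)
  have hb' : (gluedBase D).Matches hA (gluedFst D.base.tm) b' b := matches_glueFam
  have hfib {c : C} (z : Z.psh.obj (op c)) : fiber b' z rfl = β z := fiber_glueFam z
  refine ⟨b', ⟨?_, hb', ?_⟩, ?_⟩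
  · refine fam_ext hb'.mapTp hB fun c z => ?_
    rw [fiber_map_tp, hfib, (hβ z).1]
  · refine glued_ext hf.symm fun c z => ?_
    rw [val_gluedLam, ← hβl z]
    exact D.lam_congr rfl (fun _ _ _ _ _ => rfl) fun _ _ _ _ _ => by rw [hfib]
  · rintro b'' ⟨rfl, hb'', rfl⟩
    refine fam_ext hb'' hb' fun c z => ?_
    rw [hfib]
    exact hβu z _ ⟨rfl, matches_fiber hb'' z rfl rfl _, rfl⟩

end Pi

/-! ### Booleans, computed fibrewise. -/

variable (D Z) in
/-- The type of booleans of the glued displayed model. -/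
def gluedBool : (glued D.base.ty).obj (op Z) :=
  gluedMk D.base.ty (M.bool _) (fun {c} _ => D.bool c) (fun σ _ => (D.bool_res σ).symm)
    (fun {c} z => by rw [D.base_bool, M.bool_res])

variable (D Z) in
/-- The value `true` of the glued displayed model. -/
def gluedTt : (glued D.base.tm).obj (op Z) :=
  gluedMk D.base.tm (M.tt _) (fun {c} _ => D.tt c) (fun σ _ => (D.tt_res σ).symm)
    (fun {c} z => by rw [D.base_tt, M.tt_res])

variable (D Z) in
/-- The value `false` of the glued displayed model. -/
def gluedFf : (glued D.base.tm).obj (op Z) :=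
  gluedMk D.base.tm (M.ff _) (fun {c} _ => D.ff c) (fun σ _ => (D.ff_res σ).symm)
    (fun {c} z => by rw [D.base_ff, M.ff_res])

theorem tp_gluedTt (Z : Glueing F) : ap (gluedTp D) (gluedTt D Z) = gluedBool D Z :=
  glued_ext (M.tp_tt _) fun c _ => D.tp_tt c

theorem tp_gluedFf (Z : Glueing F) : ap (gluedTp D) (gluedFf D Z) = gluedBool D Z :=
  glued_ext (M.tp_ff _) fun c _ => D.tp_ff c

theorem gluedBool_res {Z' : Glueing F} (θ : Z' ⟶ Z) :
    res (glued D.base.ty) θ (gluedBool D Z) = gluedBool D Z' :=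
  glued_ext (M.bool_res _) fun _ _ => rfl

theorem fst_gluedBool : act (gluedFst D.base.ty) (gluedBool D Z) = M.bool ((proj F).obj Z) :=
  rfl

theorem val_gluedBool {c : C} (z : Z.psh.obj (op c)) : val (gluedBool D Z) z = D.bool c :=
  rfl

theorem val_tp_eq_at' {P' : Fam (gluedFamily D) (gluedBool D Z) (glued D.base.ty)}
    {t a : (glued D.base.tm).obj (op Z)}
    {ha : ap (gluedTp D) a = gluedBool D Z} (ht : ap (gluedTp D) t = P'.at' a ha) {c : C}
    (z : Z.psh.obj (op c)) (h' : ap D.tp (val a z) = D.bool c) :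
    ap D.tp (val t z) = (fiber P' z (val_gluedBool z)).at' (val a z) h' := by
  rw [← val_tp, ht]
  exact val_at' P' a ha z rfl h'

/-- The eliminator of the booleans of the glued displayed model. -/
def gluedBoolElim (P : Fam M.toTypeFamily (M.bool ((proj F).obj Z)) M.Ty)
    (P' : Fam (gluedFamily D) (gluedBool D Z) (glued D.base.ty))
    (hP : (gluedBase D).Matches fst_gluedBool (gluedFst D.base.ty) P' P)
    (t f b : (glued D.base.tm).obj (op Z))
    (ht : ap (gluedTp D) t = P'.at' (gluedTt D Z) (tp_gluedTt Z))
    (hf : ap (gluedTp D) f = P'.at' (gluedFf D Z) (tp_gluedFf Z))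
    (hb : ap (gluedTp D) b = gluedBool D Z) : (glued D.base.tm).obj (op Z) :=
  gluedMk D.base.tm (M.boolElim P (act (gluedFst D.base.tm) t) (act (gluedFst D.base.tm) f)
      (act (gluedFst D.base.tm) b) (hP.tp_eq_at' ht rfl _) (hP.tp_eq_at' hf rfl _)
      (by rw [← fst_tp, hb]; rfl))
    (fun {c} z => D.boolElim (P.restrict (pi z) (M.bool_res _)) (fiber P' z (val_gluedBool z))
      (matches_fiber hP z (val_gluedBool z) _ (D.base_bool c)) (val t z) (val f z) (val b z)
      (val_tp_eq_at' ht z (D.tp_tt c)) (val_tp_eq_at' hf z (D.tp_ff c))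
      (by rw [← val_tp, hb, val_gluedBool]))
    (fun {c d} σ z => by
      -- Typing of the restricted branches, stated for any point `a` of the booleans so as to serve
      -- both `true` and `false`.
      have key : ∀ (t a : (glued D.base.tm).obj (op Z)) (ha : ap (gluedTp D) a = gluedBool D Z)
          (ht : ap (gluedTp D) t = P'.at' a ha) (a' : D.Tm.obj (op d))
          (ha' : ap D.tp a' = D.bool d),
          val a (res Z.psh σ z) = a' → ap D.tp (res D.Tm σ (val t z)) =
            ((fiber P' z (val_gluedBool z)).restrict σ (D.bool_res σ)).at' a' ha' := by
        rintro t a ha ht _ ha' rfl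
        rw [← res_val, val_tp_eq_at' ht _ ha', Fam.at'_restrict]
        refine (fiber_res P' σ z (val_gluedBool z) _ (𝟙 d) _ _
          (by rw [ha', Category.id_comp, D.bool_res])).trans ?_
        exact (fiber P' z (val_gluedBool z)).val_congr _ (Category.id_comp _) rfl
      refine Eq.trans ?_ (D.boolElim_res σ _ _ _ _ _ _ _ _ _ (key t _ _ ht _ _ rfl)
        (key f _ _ hf _ _ rfl) (by rw [← res_val, ← val_tp, hb, val_gluedBool])).symm
      refine D.boolElim_congr (fun Δ τ a h => ?_) (fun Δ τ a h => ?_) (res_val t σ z)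
        (res_val f σ z) (res_val b σ z)
      · refine P.val_congr _ ?_ rfl
        rw [pi_res, Category.assoc]
      · exact fiber_res P' σ z (val_gluedBool z) _ τ a h (by rw [res_comp, D.bool_res, h]))
    (fun {c} z => by
      have hPz := matches_fiber hP z (val_gluedBool z) (M.bool_res _) (D.base_bool c)
      have ht₁ := hPz.tp_eq_at' (val_tp_eq_at' ht z (D.tp_tt c)) (D.base_tt c) (M.tp_tt _)
      have hf₁ := hPz.tp_eq_at' (val_tp_eq_at' hf z (D.tp_ff c)) (D.base_ff c) (M.tp_ff _)
      have hb₁ : ap M.tp (act D.base.tm (val b z)) = M.bool _ := by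
        rw [D.base.tp_tm, ← val_tp, hb, val_gluedBool, D.base_bool]
      refine (D.base_boolElim _ _ hPz _ _ _ _ _ _ ht₁ hf₁ hb₁).trans (Eq.trans ?_
        (M.boolElim_res (pi z) P _ _ _ _ _ _ (by rwa [act_val] at ht₁)
          (by rwa [act_val] at hf₁) (by rwa [act_val] at hb₁)).symm)
      congr 1 <;> exact act_val _ z)

end Glueing

namespace Glueing

variable {C : Type u} [Category.{u} C] {S : Type u} [Category.{u} S] {F : C ⥤ S}
  {M : Model.{u} S} {D : DispModel F M} {Z : Glueing F}

theorem val_gluedBoolElim (P : Fam M.toTypeFamily (M.bool ((proj F).obj Z)) M.Ty)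
    (P' : Fam (gluedFamily D) (gluedBool D Z) (glued D.base.ty))
    (hP : (gluedBase D).Matches fst_gluedBool (gluedFst D.base.ty) P' P)
    (t f b : (glued D.base.tm).obj (op Z)) (ht hf hb) {c : C} (z : Z.psh.obj (op c)) :
    val (gluedBoolElim P P' hP t f b ht hf hb) z =
      D.boolElim (P.restrict (pi z) (M.bool_res _)) (fiber P' z (val_gluedBool z))
        (matches_fiber hP z (val_gluedBool z) _ (D.base_bool c)) (val t z) (val f z) (val b z)
        (val_tp_eq_at' ht z (D.tp_tt c)) (val_tp_eq_at' hf z (D.tp_ff c))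
        (by rw [← val_tp, hb, val_gluedBool]) :=
  rfl

variable (D) in
/-- The displayed model over the glueing category. -/
def gluedModel : DispModel (proj F) M where
  toTypeFamily := gluedFamily D
  base := gluedBase D
  Pi := gluedPi
  base_Pi _ _ _ _ _ := rfl
  Pi_res {Z Z'} θ A B A' hA B' hB hA' := by
    -- Here and below, an equation between glued elements splits into the equation of `M` for the
    -- base and that of `D` at every element of the presheaf.
    refine glued_ext ((act_res _ _ _).trans (M.Pi_res _ A B)) fun c z => ?_
    rw [val_res, val_gluedPi, val_gluedPi]
    refine D.Pi_congr rfl (fun Δ σ a h₁ h₂ => ?_) fun Δ σ a h₁ h₂ => ?_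
    · refine B.val_congr _ ?_ rfl
      rw [pi_push, Category.assoc]
    · exact (fiber_restrict B' θ rfl z _ _ σ a h₂ h₁).symm
  lam := gluedLam
  base_lam _ _ _ _ _ := rfl
  lam_res {Z Z'} θ A b A' hA b' hb hA' := by
    refine glued_ext ((act_res _ _ _).trans (M.lam_res _ A b)) fun c z => ?_
    rw [val_res, val_gluedLam, val_gluedLam]
    refine D.lam_congr rfl (fun Δ σ a h₁ h₂ => ?_) fun Δ σ a h₁ h₂ => ?_
    · refine b.val_congr _ ?_ rfl
      rw [pi_push, Category.assoc]
    · exact (fiber_restrict b' θ rfl z _ _ σ a h₂ h₁).symm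
  tp_lam b A' hA b' hb := glued_ext (M.tp_lam _ b) fun c z => D.tp_lam _ _ _ _ _
  lam_bijective := gluedLam_bijective
  bool Z := gluedBool D Z
  bool_res θ := gluedBool_res θ
  base_bool _ := rfl
  tt Z := gluedTt D Z
  tt_res θ := glued_ext (M.tt_res _) fun _ _ => rfl
  tp_tt := tp_gluedTt
  base_tt _ := rfl
  ff Z := gluedFf D Z
  ff_res θ := glued_ext (M.ff_res _) fun _ _ => rfl
  tp_ff := tp_gluedFf
  base_ff _ := rfl
  boolElim := gluedBoolElim
  base_boolElim _ _ _ _ _ _ _ _ _ _ _ _ := rfl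
  tp_boolElim P P' hP t f b ht hf hb := glued_ext
    ((M.tp_boolElim _ _ _ _ _ _ _).trans (hP.at' b hb _)) fun c z => by
      rw [val_tp, val_gluedBoolElim]
      exact (D.tp_boolElim _ _ _ _ _ _ _ _ _).trans (val_at' P' b hb z _ _).symm
  boolElim_res θ P P' hP t f b ht hf hb ht' hf' hb' := by
    refine glued_ext ((act_res _ _ _).trans (M.boolElim_res _ P _ _ _ _ _ _ _ _ _)) fun c z => ?_
    rw [val_res, val_gluedBoolElim, val_gluedBoolElim]
    refine D.boolElim_congr (fun Δ σ a h => ?_) (fun Δ σ a h => ?_) rfl rfl rfl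
    · refine P.val_congr _ ?_ rfl
      rw [pi_push, Category.assoc]
    · exact (fiber_restrict P' θ _ z _ _ σ a h h).symm
  boolElim_tt P P' hP t f ht hf := glued_ext (M.boolElim_tt _ _ _ _ _) fun c z =>
    D.boolElim_tt _ _ _ _ _ _ _
  boolElim_ff P P' hP t f ht hf := glued_ext (M.boolElim_ff _ _ _ _ _) fun c z =>
    D.boolElim_ff _ _ _ _ _ _ _

/-! ### Context extensions of the glued displayed model -/

section Extension

variable (A' : (glued D.base.ty).obj (op Z))

/-- The presheaf of the context extension of `Z` by `A'`. -/
def extPsh : Cᵒᵖ ⥤ Type u where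
  obj c := {za : Z.psh.obj (op c.unop) × D.Tm.obj (op c.unop) // ap D.tp za.2 = val A' za.1}
  map σ := TypeCat.ofHom fun za => ⟨(res Z.psh σ.unop za.1.1, res D.Tm σ.unop za.1.2), by
    rw [ap_res, za.2, res_val]⟩
  map_id c := by
    ext za
    · exact res_id Z.psh za.1.1
    · exact res_id D.Tm za.1.2
  map_comp σ τ := by
    ext za
    · exact res_comp Z.psh _ _ za.1.1
    · exact res_comp D.Tm _ _ za.1.2

variable {A'} {E : S} {p : E ⟶ (proj F).obj Z} {q : M.Tm.obj (op E)}
  (hE : IsExtension M.tp (act (gluedFst D.base.ty) A') p q)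

theorem tp_extPsh {c : C} (z : Z.psh.obj (op c)) (a : D.Tm.obj (op c))
    (h : ap D.tp a = val A' z) :
    ap M.tp (act D.base.tm a) = res M.Ty (pi z) (act (gluedFst D.base.ty) A') := by
  rw [D.base.tp_tm, h, act_val]

/-- The context extension of `Z` by `A'`. -/
noncomputable def extObj : Glueing F where
  ctx := E
  psh := extPsh A'
  π za := hE.lift (pi za.1.1) (act D.base.tm za.1.2) (tp_extPsh _ _ za.2)
  π_res σ za := by
    refine hE.hom_ext ?_ ?_
    · rw [hE.lift_p, Category.assoc, hE.lift_p]
      exact pi_res σ za.1.1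
    · rw [hE.lift_q, res_comp, hE.lift_q]
      exact act_res D.base.tm σ za.1.2

/-- The projection of a context extension. -/
noncomputable def extProj : extObj hE ⟶ Z where
  fst := p
  snd :=
    { app := fun _ => TypeCat.ofHom fun za => za.1.1
      naturality := fun _ _ _ => rfl }
  isOver za := (hE.lift_p (pi za.1.1) (act D.base.tm za.1.2) (tp_extPsh _ _ za.2)).symm

/-- The generic element of a context extension. -/
noncomputable def extGen : (glued D.base.tm).obj (op (extObj hE)) :=
  gluedMk D.base.tm (Z := extObj hE) q (fun za => za.1.2) (fun _ _ => rfl)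
    fun za => (hE.lift_q (pi za.1.1) (act D.base.tm za.1.2) (tp_extPsh _ _ za.2)).symm

/-- The base component is the universal property in `M`, the presheaf component that of pairs. The
two fit together (`h₁`) because morphisms into `E` are determined by their components. -/
theorem isExtension_extObj : IsExtension (gluedTp D) A' (extProj hE) (extGen hE) where
  isOver := glued_ext hE.isOver fun _ za => za.2
  existsUnique_lift {W} θ a h := by
    have h₀ : ap M.tp (act (gluedFst D.base.tm) a) =
        res M.Ty ((proj F).map θ) (act (gluedFst D.base.ty) A') := (gluedBase D).tp_tm_eq rfl h
    have h₁ {c : C} (w : W.psh.obj (op c)) :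
        hE.lift (pi (push θ w)) (act D.base.tm (val a w)) (tp_extPsh _ _ (tp_val h w)) =
          pi w ≫ hE.lift ((proj F).map θ) (act (gluedFst D.base.tm) a) h₀ := by
      refine hE.hom_ext ?_ ?_
      · rw [hE.lift_p, Category.assoc, hE.lift_p, pi_push]
      · rw [hE.lift_q, res_comp, hE.lift_q, act_val]
    let τ : W ⟶ extObj hE :=
      { fst := hE.lift ((proj F).map θ) (act (gluedFst D.base.tm) a) h₀
        snd :=
          { app := fun c => TypeCat.ofHom fun w =>
              ⟨(push θ (c := c.unop) w, val a (c := c.unop) w), tp_val h _⟩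
            naturality := fun c d σ => by
              ext w
              exact Subtype.ext (Prod.ext (push_res θ σ.unop w) (res_val a σ.unop w)) }
        isOver := h₁ }
    refine ⟨τ, ⟨hom_ext (hE.lift_p _ _ h₀) fun _ _ => rfl,
      glued_ext (hE.lift_q _ _ h₀) fun _ _ => rfl⟩, ?_⟩
    rintro τ' ⟨rfl, rfl⟩
    refine hom_ext (hE.hom_ext ?_ ?_) fun _ _ => rfl
    · exact (hE.lift_p _ _ h₀).symm
    · exact (hE.lift_q _ _ h₀).symm

end Extension

variable (F) in
-- The terminal context with the one-point presheaf.
theorem exists_terminal (hS : HasTerminal S) :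
    ∃ Z : Glueing F, Nonempty (IsTerminal Z) ∧ Nonempty (IsTerminal ((proj F).obj Z)) := by
  have hT : IsTerminal (⊤_ S) := terminalIsTerminal
  refine ⟨⟨⊤_ S, (Functor.const _).obj PUnit, fun _ => hT.from _, fun _ _ => hT.hom_ext _ _⟩,
    ⟨IsTerminal.ofUniqueHom (fun Z => ⟨hT.from _, ⟨fun _ => TypeCat.ofHom fun _ => ⟨⟩, ?_⟩, ?_⟩)
      fun Z m => hom_ext (hT.hom_ext _ _) fun _ _ => rfl⟩, ⟨hT⟩⟩
  · intros
    rfl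
  · intros
    exact hT.hom_ext _ _

theorem exists_isExtension (Z : Glueing F) (A' : (glued D.base.ty).obj (op Z)) :
    ∃ (E : Glueing F) (p : E ⟶ Z) (q : (glued D.base.tm).obj (op E)),
      IsExtension (gluedTp D) A' p q ∧
      IsExtension M.tp (act (gluedFst D.base.ty) A') ((proj F).map p)
        (act (gluedFst D.base.tm) q) := by
  obtain ⟨E, p, q, hE⟩ := M.rep _ (act (gluedFst D.base.ty) A')
  exact ⟨_, _, _, isExtension_extObj hE, hE⟩

theorem hasContextExtensions_gluedModel : (gluedModel D).HasContextExtensions where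
  hasTerminal := by
    obtain ⟨Z, ⟨hZ⟩, -⟩ := exists_terminal F M.hasTerminal
    exact hZ.hasTerminal
  terminal := by
    obtain ⟨Z, ⟨hZ⟩, ⟨hZ'⟩⟩ := exists_terminal F M.hasTerminal
    exact PreservesTerminal.of_exists hZ hZ'
  rep Z A' := by
    obtain ⟨E, p, q, h, -⟩ := exists_isExtension Z A'
    exact ⟨E, p, q, h⟩
  ext := PreservesExtensions.of_exists exists_isExtension

/-! ### The factorization through the glueing category -/

variable (D) in
/-- The action of the embedding on types and terms. -/
abbrev embedding : FamilyMap (Y F) D.toTypeFamily (gluedFamily D) where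
  ty := mkEltHom D.base.ty
  tm := mkEltHom D.base.tm
  tp_tm a := tp_mkElt a

section Fiber

variable {c : C} {A' : D.Ty.obj (op c)} {A'' : (glued D.base.ty).obj (op ((Y F).obj c))}
  {X : Cᵒᵖ ⥤ Type u} {X' : Sᵒᵖ ⥤ Type u} {b : X ⟶ F.op ⋙ X'}

/-- The fibers of a family over a representable object. -/
theorem fiber_yo {hA : act (embedding D).ty A' = A''} {B' : Fam D.toTypeFamily A' X}
    {B'' : Fam (gluedFamily D) A'' (glued b)}
    (hB : (embedding D).Matches hA (mkEltHom b) B' B'') {d d' : C} (σ : d ⟶ c)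
    {A₀ : D.Ty.obj (op d)} (e : val A'' (yo σ) = A₀) (τ : d' ⟶ d) (a : D.Tm.obj (op d'))
    (h) (h' : ap D.tp a = res D.Ty (τ ≫ σ) A') :
    (fiber B'' (yo σ) e).val τ a h = B'.val (τ ≫ σ) a h' := by
  have h₁ := hB (τ ≫ σ) a h'
  have h₂ : (fiber B'' (yo σ) e).val τ a h = val (mkElt b (B'.val (τ ≫ σ) a h')) (yo (𝟙 d')) := by
    refine congrArg (fun k : (glued b).obj (op ((Y F).obj d')) => val k (yo (𝟙 d'))) ?_
    refine Eq.trans ?_ h₁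
    exact B''.val_congr _ (point_yo (τ ≫ σ)) rfl
  rw [h₂, val_mkElt, res_id]

end Fiber

variable (D) in
/-- The factorization of a displayed model without context extensions through the glueing
category. -/
def factorization : Factorization D where
  P := Glueing F
  Y := Y F
  G := proj F
  fac := Iso.refl F
  full := inferInstance
  faithful := inferInstance
  disp := gluedModel D
  hasExt := hasContextExtensions_gluedModel
  map := embedding D
  base_ty A := (res_id M.Ty _).symm
  base_tm A := (res_id M.Tm _).symm
  bij_ty := mkElt_bijective
  bij_tm := mkElt_bijective
  Pi {c A} B A' hA B' hB B'' hBB hA'' hB'' := by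
    -- As `fac` is the identity, families of `M` on the right are restricted along `𝟙 (F.obj c)`:
    -- `M.Pi_res` at the identity settles the base part. At `σ` the claim is stability of `D.Pi`
    -- under `σ`, since the fibre over `yo σ` is restriction along `σ` (`fiber_yo`).
    refine glued_ext ((D.base_Pi B A' hA B' hB).trans
      ((res_id M.Ty _).symm.trans (M.Pi_res (𝟙 (F.obj c)) A B))) fun d (σ : d ⟶ c) => ?_
    refine (D.Pi_res σ B A' hA B' hB (by rw [act_res, hA])).trans ?_
    refine D.Pi_congr rfl (fun Δ τ a h₁ h₂ => ?_) fun Δ τ a h₁ h₂ => ?_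
    · exact B.val_congr _ (Category.comp_id _).symm rfl
    · exact (fiber_yo hBB σ _ τ a _ _).symm
  lam {c A} b A' hA b' hb b'' hbb hA'' hb'' := by
    refine glued_ext ((D.base_lam b A' hA b' hb).trans
      ((res_id M.Tm _).symm.trans (M.lam_res (𝟙 (F.obj c)) A b))) fun d (σ : d ⟶ c) => ?_
    refine (D.lam_res σ b A' hA b' hb (by rw [act_res, hA])).trans ?_
    refine D.lam_congr rfl (fun Δ τ a h₁ h₂ => ?_) fun Δ τ a h₁ h₂ => ?_
    · exact b.val_congr _ (Category.comp_id _).symm rfl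
    · exact (fiber_yo hbb σ _ τ a _ _).symm
  bool c := glued_ext (D.base_bool c) fun _ σ => D.bool_res σ
  tt c := glued_ext (D.base_tt c) fun _ σ => D.tt_res σ
  ff c := glued_ext (D.base_ff c) fun _ σ => D.ff_res σ
  boolElim {c} Q Q' hQ Q'' hQQ hQ'' t f b ht hf hb ht' hf' hb' := by
    have ht₁ := hQ.tp_eq_at' ht (D.base_tt c) (M.tp_tt _)
    have hf₁ := hQ.tp_eq_at' hf (D.base_ff c) (M.tp_ff _)
    have hb₁ : ap M.tp (act D.base.tm b) = M.bool _ := by rw [D.base.tp_tm, hb, D.base_bool]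
    have hid : Q.restrict (𝟙 (F.obj c)) (M.bool_res _) = Q := Q.restrict_id _
    refine glued_ext ((D.base_boolElim Q Q' hQ t f b ht hf hb ht₁ hf₁ hb₁).trans ?_)
      fun d (σ : d ⟶ c) => ?_
    · change _ = M.boolElim (Q.restrict (𝟙 (F.obj c)) (M.bool_res _)) (act D.base.tm t)
        (act D.base.tm f) (act D.base.tm b) _ _ _
      congr 1
      exact hid.symm
    · have key : ∀ (s a : D.Tm.obj (op c)) (ha : ap D.tp a = D.bool c)
          (hs : ap D.tp s = Q'.at' a ha) (a' : D.Tm.obj (op d)) (ha' : ap D.tp a' = D.bool d),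
          res D.Tm σ a = a' →
          ap D.tp (res D.Tm σ s) = (Q'.restrict σ (D.bool_res σ)).at' a' ha' := by
        rintro s a ha hs _ ha' rfl
        rw [ap_res, hs, Fam.res_at', Fam.at'_restrict]
      refine (D.boolElim_res σ Q Q' hQ t f b ht hf hb (key t _ _ ht _ _ (D.tt_res σ))
        (key f _ _ hf _ _ (D.ff_res σ)) (by rw [ap_res, hb, D.bool_res])).trans ?_
      refine D.boolElim_congr (fun Δ τ a h => ?_) (fun Δ τ a h => ?_) rfl rfl rfl
      · exact Q.val_congr _ (Category.comp_id _).symm rfl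
      · exact (fiber_yo hQQ σ _ τ a _ _).symm

end Glueing

end RelativeInduction

/-- Let `M` be the biinitial model, `𝓡` its category of renamings and `D` a displayed model without
context extensions over `𝓡.F`. The model `D` has factorizations; every factorization has a section
`S₀` of its displayed model with context extensions; and, given displayed interpretations of the
variables in the displayed inserter of `S₀`, there is a relative section `(S₀, α)`, which sends
every variable to its displayed interpretation. -/
theorem mainTheorem2 {S : Type u} [Category.{u} S] (M : Model.{u} S)
    (hM : Model.IsBiinitial.{u, u, u, u + 1, u} M) {R : Type u} [Category.{u} R]
    (𝓡 : RenamingAlgebra M R) (h𝓡 : 𝓡.IsBiinitial) (D : DispModel 𝓡.F M) :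
    Nonempty (Factorization D) ∧
    ∀ 𝓕 : Factorization D, Nonempty (DispSection 𝓕.disp) ∧
      ∀ (S₀ : DispSection 𝓕.disp) (var' : VarInterpretation 𝓡 𝓕 S₀),
        ∃ s : RelativeSection 𝓕 S₀, ∀ (x : R) (a : 𝓡.Var.obj (op x)),
          s.onTm (act 𝓡.var a) =
            var'.val (s.toInserter.obj x) (act 𝓡.vtp a) (𝟙 x) a (𝓡.vtp_id a) :=
  -- The last equation is `IsGood` at `(x, α_x)` by definition.
  ⟨⟨Glueing.factorization D⟩, fun 𝓕 => ⟨hM.nonempty_dispSection 𝓕.hasExt, fun _ var' =>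
    h𝓡.exists_relativeSection var'⟩⟩
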